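/- **Setting.** Let $\mathbb X\subset\mathbb R^n$ be Lebesgue measurable and let $(X_t)$ be a time-homogeneous continuous-time Markov process on $\mathbb X$ whose transition probability functions have Lebesgue densities: $P^t(x,B)=\int_B p^t(x,y)\,dy$ for $t>0$, with $p^t\ge 0$ jointly measurable. Suppose the process has a unique stationary probability measure $\mu$, that $\mu$ has a continuous, strictly positive Lebesgue density $\pi$, and that $p^t(x,y)\pi(x)=p^t(y,x)\pi(y)$ for all $x,y\in\mathbb X$, $t>0$. Let $\lambda$ be Lebesgue measure on $\mathbb X$ and $\|\cdot\|_{\mathbb K}$ the norm of $\mathbb K=L^1_{\mu\times\lambda}(\mathbb X^2)$. Fix a lag time $\tau>0$, write $p=p^\tau$, and let $r\le n$. Let $\mathbb Z\subset\mathbb R^r$ be a Borel set (e.g. a domain), $|\mathbb Z|$ its Lebesgue measure, and $\xi:\mathbb X\to\mathbb Z$ a reaction coordinate that is $C^1$ on a neighbourhood of $\mathbb X$ with $\det(\nabla\xi^\intercal\nabla\xi)\neq0$ almost everywhere on $\mathbb X$. On the level set $\Sigma_\xi(z)=\{x\in\mathbb X:\xi(x)=z\}$ let $\mu_z$ be the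 marginal stationary measure $$d\mu_z=\pi\,\det(\nabla\xi^\intercal\nabla\xi)^{-1/2}\,dH_{n-r},$$ where $H_{n-r}$ is the $(n-r)$-dimensional Hausdorff measure (the density being read as $0$ at critical points). For $\varepsilon\ge0$ the system is *$\varepsilon$-deflatable* with respect to $\xi$ if there are functions $p_D^t:\mathbb X\times\mathbb Z\to[0,\infty)$ such that, for all $t\ge\tau$, the function $p^t(x,y)-p_D^t(x,\xi(y))\pi(y)$ lies in $\mathbb K$ and $$\frac1{|\mathbb Z|}\big\|p^t(\ast,\cdot)-p_D^t(\ast,\xi(\cdot))\pi(\cdot)\big\|_{\mathbb K}\le\varepsilon .\tag{D}$$ It is *differentially $\varepsilon$-deflatable* with respect to $\xi$ if $$\frac1{|\mathbb Z|}\int_{\mathbb Z}\int_{\Sigma_\xi(z)}\int_{\Sigma_\xi(z)}\Big\|\frac{p(\cdot,y^{(1)})}{\pi(y^{(1)})}-\frac{p(\cdot,y^{(2)})}{\pi(y^{(2)})}\Big\|_{L^1_\mu}d\mu_z(y^{(1)})\,d\mu_z(y^{(2)})\,dz\le\varepsilon .\tag{D'}$$ **Lemma.** Suppose that for almost every $z\in\mathbb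 Z$ the measure $\mu_z$ is a probability measure. If the system is $\varepsilon$-deflatable with respect to $\xi$, then it is differentially $2\varepsilon$-deflatable with respect to $\xi$. Conversely, if the system is differentially $\varepsilon$-deflatable with respect to $\xi$, then it is $\varepsilon$-deflatable with respect to $\xi$; more precisely, (D) holds for all $t\ge\tau$ with $$p_D^t(\cdot,z)=\int_{\Sigma_\xi(z)}\frac{p^t(\cdot,y')}{\pi(y')}\,d\mu_z(y').$$ If the $\mu_z$ are not assumed to be probability measures, both implications remain true when the inner integral over $y^{(1)}$ in (D') and the integral defining $p_D^t$ are replaced by averages, i.e. divided by $\mu_z(\Sigma_\xi(z))$. -/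

import Mathlib

open MeasureTheory ProbabilityTheory
open scoped ENNReal NNReal Matrix

noncomputable section

namespace ReactionCoordinate

/-- Lebesgue measure on a subset `X` of `ℝⁿ`. -/
def lebesgueOn {n : ℕ} (X : Set (EuclideanSpace ℝ (Fin n))) : Measure X :=
  (volume : Measure (EuclideanSpace ℝ (Fin n))).comap Subtype.val

/-- The measure on `X` with Lebesgue density `ρ`. -/
def densityMeasure {n : ℕ} {X : Set (EuclideanSpace ℝ (Fin n))} (ρ : X → ℝ) : Measure X :=
  (lebesgueOn X).withDensity fun x => ENNReal.ofReal (ρ x)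

/-- The law of a time-homogeneous continuous-time Markov process on `X ⊆ ℝⁿ`, given by its
transition probability functions `P t x B = Prob[X_{s+t} ∈ B | X_s = x]`, `t > 0`, which have
Lebesgue densities `p t x`; it has a unique stationary probability measure, whose Lebesgue density
`π` is continuous and strictly positive, and it is reversible. -/
structure MarkovSystem {n : ℕ} (X : Set (EuclideanSpace ℝ (Fin n))) where
  /-- transition probability functions -/
  P : ℝ → Kernel X X
  /-- transition densities -/
  p : ℝ → X → X → ℝ
  /-- stationary density -/
  π : X → ℝ
  isMarkovKernel_P : ∀ t, 0 < t → IsMarkovKernel (P t)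
  /-- Chapman-Kolmogorov equation (Markov property) -/
  chapman_kolmogorov : ∀ s t, 0 < s → 0 < t → P (s + t) = P t ∘ₖ P s
  p_nonneg : ∀ t, 0 < t → ∀ x y, 0 ≤ p t x y
  measurable_p : ∀ t, 0 < t → Measurable (Function.uncurry (p t))
  /-- `P t x` has Lebesgue density `p t x` -/
  P_eq_density : ∀ t, 0 < t → ∀ x, P t x = densityMeasure (p t x)
  continuous_π : Continuous π
  π_pos : ∀ x, 0 < π x
  isProbabilityMeasure_π : IsProbabilityMeasure (densityMeasure π)
  stationary : ∀ t, 0 < t → (P t).Invariant (densityMeasure π)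
  /-- the stationary measure is unique -/
  stationary_unique : ∀ ν : Measure X, IsProbabilityMeasure ν →
    (∀ t, 0 < t → (P t).Invariant ν) → ν = densityMeasure π
  detailed_balance : ∀ t, 0 < t → ∀ x y, p t x y * π x = p t y x * π y

/-- The `r × r` Gram matrix `∇ξ(x)ᵀ ∇ξ(x)`, where the columns of `∇ξ(x)` are the gradients of the
components of `ξ`. -/
def gramMatrix {n r : ℕ} (ξ : EuclideanSpace ℝ (Fin n) → EuclideanSpace ℝ (Fin r))
    (x : EuclideanSpace ℝ (Fin n)) : Matrix (Fin r) (Fin r) ℝ :=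
  let grad : Matrix (Fin n) (Fin r) ℝ :=
    Matrix.of fun i j => fderiv ℝ ξ x (EuclideanSpace.single i 1) j
  gradᵀ * grad

/-- The `z`-level set of `ξ` in `X`. -/
def levelSet {n r : ℕ} (X : Set (EuclideanSpace ℝ (Fin n)))
    (ξ : EuclideanSpace ℝ (Fin n) → EuclideanSpace ℝ (Fin r)) (z : EuclideanSpace ℝ (Fin r)) :
    Set X :=
  {x : X | ξ x = z}

variable {n r : ℕ} {X : Set (EuclideanSpace ℝ (Fin n))}

namespace MarkovSystem

/-- The stationary measure `μ`. -/
def μ (S : MarkovSystem X) : Measure X := densityMeasure S.π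

/-- The marginal stationary measure `μ_z`: it lives on the `z`-level set of `ξ` and has density
`π det(∇ξᵀ∇ξ)^(-1/2)` with respect to the `(n-r)`-dimensional Hausdorff measure (normalized to agree
with Lebesgue measure on `ℝ^(n-r)`). At critical points of `ξ` this density is read as `0`. -/
def marginal (S : MarkovSystem X) (ξ : EuclideanSpace ℝ (Fin n) → EuclideanSpace ℝ (Fin r))
    (z : EuclideanSpace ℝ (Fin r)) : Measure X :=
  ((μHE[n - r] : Measure X).restrict (levelSet X ξ z)).withDensity fun x =>
    ENNReal.ofReal (S.π x * (gramMatrix ξ x).det ^ (-(1 / 2) : ℝ))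

/-- `‖p^t(·,y₁)/π(y₁) - p^t(·,y₂)/π(y₂)‖` in `L¹_μ`. -/
def observableDist (S : MarkovSystem X) (t : ℝ) (y₁ y₂ : X) : ℝ≥0∞ :=
  eLpNorm (fun x => S.p t x y₁ / S.π y₁ - S.p t x y₂ / S.π y₂) 1 S.μ

/-- `ε`-deflatability with lag time `τ` with respect to `ξ : X → Z`, by means of the given family
`pD`: for all `t ≥ τ` the function `p^t(x,y) - p_D^t(x,ξ(y)) π(y)` belongs to
`𝕂 = L¹(μ × λ)` and its norm is at most `ε |Z|`. -/
def IsDeflatableWith (S : MarkovSystem X) (τ : ℝ)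
    (ξ : EuclideanSpace ℝ (Fin n) → EuclideanSpace ℝ (Fin r)) (Z : Set (EuclideanSpace ℝ (Fin r)))
    (pD : ℝ → X → EuclideanSpace ℝ (Fin r) → ℝ) (ε : ℝ≥0) : Prop :=
  ∀ t, τ ≤ t → (∀ x, ∀ z ∈ Z, 0 ≤ pD t x z) ∧
    MemLp (fun q : X × X => S.p t q.1 q.2 - pD t q.1 (ξ q.2) * S.π q.2) 1
      (S.μ.prod (lebesgueOn X)) ∧
    (volume Z)⁻¹ * eLpNorm (fun q : X × X => S.p t q.1 q.2 - pD t q.1 (ξ q.2) * S.π q.2) 1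
      (S.μ.prod (lebesgueOn X)) ≤ ε

/-- `ε`-deflatability with lag time `τ` with respect to `ξ : X → Z`. -/
def IsDeflatable (S : MarkovSystem X) (τ : ℝ)
    (ξ : EuclideanSpace ℝ (Fin n) → EuclideanSpace ℝ (Fin r)) (Z : Set (EuclideanSpace ℝ (Fin r)))
    (ε : ℝ≥0) : Prop :=
  ∃ pD : ℝ → X → EuclideanSpace ℝ (Fin r) → ℝ, S.IsDeflatableWith τ ξ Z pD ε

/-- Differential `ε`-deflatability at lag time `τ` with respect to `ξ : X → Z`. -/
def IsDiffDeflatable (S : MarkovSystem X) (τ : ℝ)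
    (ξ : EuclideanSpace ℝ (Fin n) → EuclideanSpace ℝ (Fin r)) (Z : Set (EuclideanSpace ℝ (Fin r)))
    (ε : ℝ≥0) : Prop :=
  (volume Z)⁻¹ * ∫⁻ z in Z, ∫⁻ y₂, ∫⁻ y₁, S.observableDist τ y₁ y₂
    ∂(S.marginal ξ z) ∂(S.marginal ξ z) ≤ ε

/-- Variant of differential `ε`-deflatability for marginal measures that are not normalized: the
inner integral is the average `μ_z(Σ(z))⁻¹ ∫ … dμ_z`. -/
def IsAvgDiffDeflatable (S : MarkovSystem X) (τ : ℝ)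
    (ξ : EuclideanSpace ℝ (Fin n) → EuclideanSpace ℝ (Fin r)) (Z : Set (EuclideanSpace ℝ (Fin r)))
    (ε : ℝ≥0) : Prop :=
  (volume Z)⁻¹ * ∫⁻ z in Z, ∫⁻ y₂, ⨍⁻ y₁, S.observableDist τ y₁ y₂
    ∂(S.marginal ξ z) ∂(S.marginal ξ z) ≤ ε

end MarkovSystem

end ReactionCoordinate

end

/-! Put `q_y = p^t(·,y)/π(y)`. Since `dμ = π dλ`, the norm in (D) equals `∫ ‖q_y - p_D(·,ξ(y))‖
dμ(y)`, with the norm of `L¹_μ` inside. The coarea formula disintegrates `μ` into the `μ_z`, so this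
is an integral over level sets, on each of which `p_D(·,ξ(y))` is one fixed function `p_D(·,z)`.
Deflatability gives the differential form by the triangle inequality through `p_D(·,z)`: both terms
average to the norm in (D), hence the factor 2 (`IsDisintegration.avgDist_le`). Conversely, if
`p_D(·,z)` is the mean of `q_y` over the level set, the distance from `q_y` to the mean is at most
the mean distance (`IsDisintegration.eLpNorm_le`). The differential form concerns only the lag `τ`,
while (D) is needed for all `t ≥ τ`. By reversibility, `‖q_{y₁} - q_{y₂}‖` is the `L¹(λ)` distance
of `p^t(y₁,·)` and `p^t(y₂,·)`, which a Markov kernel contracts; so it is antitone in `t`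
(`observableDist_antitone`). Most of the work is the coarea formula for a `C¹` map on its regular
set. Near a regular point, `(ξ, P)` with `P` the projection to the kernel of the derivative is a
chart that distorts level sets arbitrarily little. Change of variables and Fubini give the formula
up to a factor `a > 1`; a countable partition and `a → 1` finish it. The result is
`exists_kernel_marginal`. -/

noncomputable section

namespace ReactionCoordinate

/-! ### Linear algebra: the coarea factor as a determinant. -/

section Linear

variable {n r : ℕ}

theorem gramMatrix_eq_gram_adjoint
    (ξ : EuclideanSpace ℝ (Fin n) → EuclideanSpace ℝ (Fin r)) (x : EuclideanSpace ℝ (Fin n)) :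
    gramMatrix ξ x = Matrix.gram ℝ fun j =>
      ContinuousLinearMap.adjoint (fderiv ℝ ξ x) (EuclideanSpace.single j 1) := by
  ext i j
  rw [Matrix.gram_apply, ← (EuclideanSpace.basisFun (Fin n) ℝ).sum_inner_mul_inner]
  simp only [gramMatrix, Matrix.mul_apply, Matrix.transpose_apply, Matrix.of_apply]
  refine Finset.sum_congr rfl fun k _ => ?_
  rw [EuclideanSpace.basisFun_apply, ContinuousLinearMap.adjoint_inner_left,
    ContinuousLinearMap.adjoint_inner_right]
  simp [EuclideanSpace.inner_single_left, EuclideanSpace.inner_single_right]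

/-- Thus the Gram determinant is nonnegative, and it is nonzero only where the adjoint is injective,
that is, where the derivative is onto. -/
theorem det_gramMatrix_eq_normDet_sq
    (ξ : EuclideanSpace ℝ (Fin n) → EuclideanSpace ℝ (Fin r)) (x : EuclideanSpace ℝ (Fin n)) :
    (gramMatrix ξ x).det =
      (ContinuousLinearMap.adjoint (fderiv ℝ ξ x)).toLinearMap.normDet ^ 2 := by
  have := LinearMap.normDet_sq_eq_det_gram
    (ContinuousLinearMap.adjoint (fderiv ℝ ξ x)).toLinearMap (EuclideanSpace.basisFun (Fin r) ℝ)
  rw [gramMatrix_eq_gram_adjoint]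
  simpa using this.symm

theorem det_gramMatrix_nonneg
    (ξ : EuclideanSpace ℝ (Fin n) → EuclideanSpace ℝ (Fin r)) (x : EuclideanSpace ℝ (Fin n)) :
    0 ≤ (gramMatrix ξ x).det := by
  rw [det_gramMatrix_eq_normDet_sq]; positivity

/-- The kernel of the derivative at a regular point has dimension `n - r`. -/
theorem finrank_ker_fderiv
    {ξ : EuclideanSpace ℝ (Fin n) → EuclideanSpace ℝ (Fin r)} {x : EuclideanSpace ℝ (Fin n)}
    (hx : (gramMatrix ξ x).det ≠ 0) :
    Module.finrank ℝ (fderiv ℝ ξ x).ker + r = n := by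
  set L := fderiv ℝ ξ x
  rw [det_gramMatrix_eq_normDet_sq] at hx
  have h0 : (ContinuousLinearMap.adjoint L).toLinearMap.normDet ≠ 0 := fun h => hx (by simp [L, h])
  have hinj : Function.Injective (ContinuousLinearMap.adjoint L).toLinearMap :=
    ((LinearMap.normDet_ne_zero_tfae _).out 0 4).1 h0
  have hsurj : L.range = ⊤ := by
    have : L.rangeᗮ = ⊥ := by
      rw [ContinuousLinearMap.orthogonal_range]
      exact LinearMap.ker_eq_bot.2 hinj
    exact (Submodule.orthogonal_eq_bot_iff).1 this
  have := L.toLinearMap.finrank_range_add_finrank_ker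
  rw [show L.toLinearMap.range = ⊤ from hsurj] at this
  simp only [finrank_top, finrank_euclideanSpace, Fintype.card_fin] at this
  omega

/-- An isometry between the product of `ℝʳ` and `K` and the Euclidean space. -/
theorem exists_linearIsometryEquiv_prod (K : Submodule ℝ (EuclideanSpace ℝ (Fin n)))
    (hK : Module.finrank ℝ K + r = n) :
    Nonempty (WithLp 2 (EuclideanSpace ℝ (Fin r) × K) ≃ₗᵢ[ℝ] EuclideanSpace ℝ (Fin n)) := by
  let b := (EuclideanSpace.basisFun (Fin r) ℝ).prod (stdOrthonormalBasis ℝ K)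
  exact ⟨b.equiv (EuclideanSpace.basisFun (Fin n) ℝ)
    (Fintype.equivOfCardEq (by simp; omega))⟩

/-- The map `(L, P) : E → ℝʳ × K`, with `P` the orthogonal projection to `K`, read in `E`. -/
def straighten (L : EuclideanSpace ℝ (Fin n) →L[ℝ] EuclideanSpace ℝ (Fin r))
    (K : Submodule ℝ (EuclideanSpace ℝ (Fin n)))
    (e : WithLp 2 (EuclideanSpace ℝ (Fin r) × K) ≃ₗᵢ[ℝ] EuclideanSpace ℝ (Fin n)) :
    EuclideanSpace ℝ (Fin n) →L[ℝ] EuclideanSpace ℝ (Fin n) :=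
  e.toContinuousLinearEquiv.toContinuousLinearMap ∘L
    (WithLp.prodContinuousLinearEquiv 2 ℝ
      (EuclideanSpace ℝ (Fin r)) K).symm.toContinuousLinearMap ∘L
    (L.prod K.orthogonalProjectionOnto)

theorem straighten_apply (L : EuclideanSpace ℝ (Fin n) →L[ℝ] EuclideanSpace ℝ (Fin r))
    (K : Submodule ℝ (EuclideanSpace ℝ (Fin n)))
    (e : WithLp 2 (EuclideanSpace ℝ (Fin r) × K) ≃ₗᵢ[ℝ] EuclideanSpace ℝ (Fin n)) (v) :
    straighten L K e v = e (WithLp.toLp 2 (L v, K.orthogonalProjectionOnto v)) := rfl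

theorem adjoint_straighten_apply (L : EuclideanSpace ℝ (Fin n) →L[ℝ] EuclideanSpace ℝ (Fin r))
    (K : Submodule ℝ (EuclideanSpace ℝ (Fin n)))
    (e : WithLp 2 (EuclideanSpace ℝ (Fin r) × K) ≃ₗᵢ[ℝ] EuclideanSpace ℝ (Fin n))
    (u : WithLp 2 (EuclideanSpace ℝ (Fin r) × K)) :
    ContinuousLinearMap.adjoint (straighten L K e) (e u) =
      ContinuousLinearMap.adjoint L u.fst + (u.snd : EuclideanSpace ℝ (Fin n)) := by
  refine ext_inner_right ℝ fun v => ?_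
  rw [ContinuousLinearMap.adjoint_inner_left, straighten_apply]
  refine (LinearIsometryEquiv.inner_map_map (𝕜 := ℝ)
    (E := WithLp 2 (EuclideanSpace ℝ (Fin r) × K)) (E' := EuclideanSpace ℝ (Fin n)) e u _).trans ?_
  rw [WithLp.prod_inner_apply, inner_add_left, ContinuousLinearMap.adjoint_inner_left]
  congr 1
  exact K.inner_orthogonalProjectionOnto_eq_of_mem_left _ _

/-- The range of `L*` is orthogonal to `ker L`, so in an adapted orthonormal basis the Gram matrix
of the adjoint of `(L, P)` is block diagonal, with blocks the Gram matrix of `L*` and the identity.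
-/
theorem abs_det_straighten (L : EuclideanSpace ℝ (Fin n) →L[ℝ] EuclideanSpace ℝ (Fin r))
    (e : WithLp 2 (EuclideanSpace ℝ (Fin r) × L.ker) ≃ₗᵢ[ℝ] EuclideanSpace ℝ (Fin n)) :
    |(straighten L L.ker e).det| = (ContinuousLinearMap.adjoint L).toLinearMap.normDet := by
  set D := straighten L L.ker e
  let b := ((EuclideanSpace.basisFun (Fin r) ℝ).prod (stdOrthonormalBasis ℝ L.ker)).map e
  have h1 : |D.det| = (ContinuousLinearMap.adjoint D).toLinearMap.normDet := by
    rw [LinearMap.normDet_eq_norm_det, ← LinearMap.det_toMatrix b.toBasis,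
      ← ContinuousLinearMap.adjoint_toLinearMap, LinearMap.toMatrix_adjoint,
      Matrix.det_conjTranspose, LinearMap.det_toMatrix]
    simp [ContinuousLinearMap.det]
  rw [h1]
  refine (sq_eq_sq₀ (LinearMap.normDet_nonneg _) (LinearMap.normDet_nonneg _)).1 ?_
  have h2 := LinearMap.normDet_sq_eq_det_gram (ContinuousLinearMap.adjoint D).toLinearMap b
  have h4 := LinearMap.normDet_sq_eq_det_gram
    (ContinuousLinearMap.adjoint L).toLinearMap (EuclideanSpace.basisFun (Fin r) ℝ)
  have hker : ∀ (i : EuclideanSpace ℝ (Fin r)) (w : L.ker), inner ℝ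
      (ContinuousLinearMap.adjoint L i) (w : EuclideanSpace ℝ (Fin n)) = 0 := by
    intro i w
    rw [ContinuousLinearMap.adjoint_inner_left, show L w = 0 from w.2, inner_zero_right]
  have hon := (stdOrthonormalBasis ℝ L.ker).orthonormal
  rw [orthonormal_iff_ite] at hon
  have hl : ∀ j, (ContinuousLinearMap.adjoint D).toLinearMap (b (Sum.inl j)) =
      ContinuousLinearMap.adjoint L (EuclideanSpace.basisFun (Fin r) ℝ j) := by
    intro j
    refine (adjoint_straighten_apply L L.ker e _).trans ?_
    simp
  have hr : ∀ j, (ContinuousLinearMap.adjoint D).toLinearMap (b (Sum.inr j)) =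
      (stdOrthonormalBasis ℝ L.ker j : EuclideanSpace ℝ (Fin n)) := by
    intro j
    refine (adjoint_straighten_apply L L.ker e _).trans ?_
    simp
  have h3 : (Matrix.gram ℝ fun i => (ContinuousLinearMap.adjoint D).toLinearMap (b i)) =
      Matrix.fromBlocks (Matrix.gram ℝ fun j => (ContinuousLinearMap.adjoint L).toLinearMap
        (EuclideanSpace.basisFun (Fin r) ℝ j)) 0 0 1 := by
    ext (i | i) (j | j)
    · rw [Matrix.gram_apply, hl, hl]; rfl
    · rw [Matrix.gram_apply, hl, hr, hker]; rfl
    · rw [Matrix.gram_apply, hl, hr, real_inner_comm, hker]; rfl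
    · rw [Matrix.gram_apply, hr, hr, Matrix.fromBlocks_apply₂₂, Matrix.one_apply]
      exact hon i j
  rw [h3, Matrix.det_fromBlocks_zero₂₁, Matrix.det_one, mul_one, ← h4] at h2
  simpa using h2

end Linear

/-! ### Hausdorff measure under Lipschitz and expanding maps. -/

section Hausdorff

variable {A B : Type*} [MetricSpace A] [MeasurableSpace A] [BorelSpace A]
  [MetricSpace B] [MeasurableSpace B] [BorelSpace B]

theorem euclideanHausdorffMeasure_image_le {f : A → B} {s : Set A} (hf : LipschitzOnWith 1 f s)
    (d : ℕ) : μHE[d] (f '' s) ≤ μHE[d] s := by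
  simp only [Measure.euclideanHausdorffMeasure_def, Measure.smul_apply]
  have := hf.hausdorffMeasure_image_le (d := d) (Nat.cast_nonneg d)
  simp only [ENNReal.coe_one, ENNReal.one_rpow, one_mul] at this
  exact smul_le_smul_of_nonneg_left this zero_le

theorem euclideanHausdorffMeasure_le_image {f : A → B} {s : Set A} {b : ℝ≥0}
    (hf : ∀ x ∈ s, ∀ y ∈ s, dist x y ≤ b * dist (f x) (f y)) (d : ℕ) :
    μHE[d] s ≤ (b : ℝ≥0∞) ^ d * μHE[d] (f '' s) := by
  have h1 : AntilipschitzWith b (fun x : s => f x) :=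
    AntilipschitzWith.of_le_mul_dist fun x y => hf x x.2 y y.2
  have h2 := h1.le_hausdorffMeasure_image (d := d) (Nat.cast_nonneg d) Set.univ
  have h3 : (fun x : s => f x) '' Set.univ = f '' s := by
    rw [Set.image_univ]; ext; simp
  have h4 : μHE[d] s = μHE[d] (Set.univ : Set s) := by
    have := (isometry_subtype_coe (s := s)).euclideanHausdorffMeasure_image (d := d) Set.univ
    rwa [Set.image_univ, Subtype.range_coe] at this
  rw [h4]
  simp only [Measure.euclideanHausdorffMeasure_def, Measure.smul_apply]
  rw [h3, ENNReal.rpow_natCast] at h2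
  calc _ ≤ _ • ((b : ℝ≥0∞) ^ d * μH[d] (f '' s)) := smul_le_smul_of_nonneg_left h2 zero_le
    _ = _ := by simp only [ENNReal.smul_def, smul_eq_mul]; ring

end Hausdorff

/-! ### The coarea formula near a regular point, up to a factor. -/

section Local

variable {n r : ℕ}

/-- The coarea factor of `ξ`. -/
def coareaFactor (ξ : EuclideanSpace ℝ (Fin n) → EuclideanSpace ℝ (Fin r))
    (x : EuclideanSpace ℝ (Fin n)) : ℝ := √(gramMatrix ξ x).det

theorem measurable_det_gramMatrix (ξ : EuclideanSpace ℝ (Fin n) → EuclideanSpace ℝ (Fin r)) :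
    Measurable fun x => (gramMatrix ξ x).det := by
  have h : Measurable (fderiv ℝ ξ) := measurable_fderiv ℝ ξ
  have h2 : ∀ i j, Measurable fun x => gramMatrix ξ x i j := by
    intro i j
    simp only [gramMatrix, Matrix.mul_apply, Matrix.transpose_apply, Matrix.of_apply]
    have h3 : ∀ (k : Fin n) (i : Fin r), Measurable fun x =>
        (fderiv ℝ ξ x (EuclideanSpace.single k 1)) i := fun k i =>
      (EuclideanSpace.proj (𝕜 := ℝ) i).measurable.comp
        ((ContinuousLinearMap.apply ℝ _ (EuclideanSpace.single k 1)).measurable.comp h)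
    exact Finset.measurable_fun_sum _ fun k _ => (h3 k i).mul (h3 k j)
  simp only [Matrix.det_apply']
  exact Finset.measurable_fun_sum _ fun σ _ =>
    (Finset.measurable_fun_prod _ fun i _ => h2 _ _).const_mul _

theorem continuousOn_det_gramMatrix {ξ : EuclideanSpace ℝ (Fin n) → EuclideanSpace ℝ (Fin r)}
    {U : Set (EuclideanSpace ℝ (Fin n))} (hU : IsOpen U) (hξ : ContDiffOn ℝ 1 ξ U) :
    ContinuousOn (fun x => (gramMatrix ξ x).det) U := by
  have h := hξ.continuousOn_fderiv_of_isOpen hU le_rfl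
  have h2 : ContinuousOn (fun x => gramMatrix ξ x) U := by
    refine continuousOn_pi.2 fun i => continuousOn_pi.2 fun j => ?_
    simp only [gramMatrix, Matrix.mul_apply, Matrix.transpose_apply, Matrix.of_apply]
    have h3 : ∀ (k : Fin n) (i : Fin r), ContinuousOn (fun x =>
        (fderiv ℝ ξ x (EuclideanSpace.single k 1)) i) U := fun k i =>
      (EuclideanSpace.proj (𝕜 := ℝ) i).continuous.comp_continuousOn
        ((ContinuousLinearMap.apply ℝ _ (EuclideanSpace.single k 1)).continuous.comp_continuousOn h)
    exact continuousOn_finsetSum _ fun k _ => (h3 k i).mul (h3 k j)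
  exact (Continuous.matrix_det continuous_id).comp_continuousOn h2

/-- Here `v z` is the Lebesgue measure of the projection of `B ∩ ξ⁻¹{z}` to the kernel of the
derivative at `x₀`. The projection is 1-Lipschitz, and on small level pieces its inverse is
Lipschitz with constant near 1. The integral of `v` is the volume of the image of `B` under the
chart `(ξ, P)`. -/
theorem exists_nhd_coarea_bounds {ξ : EuclideanSpace ℝ (Fin n) → EuclideanSpace ℝ (Fin r)}
    {U : Set (EuclideanSpace ℝ (Fin n))} (hU : IsOpen U) (hξ : ContDiffOn ℝ 1 ξ U)
    {x₀ : EuclideanSpace ℝ (Fin n)} (hx₀ : x₀ ∈ U) (hdet : (gramMatrix ξ x₀).det ≠ 0)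
    {a : ℝ≥0} (ha : 1 < a) :
    ∃ V, IsOpen V ∧ x₀ ∈ V ∧ V ⊆ U ∧ ∀ B ⊆ V, MeasurableSet B →
      ∃ v : EuclideanSpace ℝ (Fin r) → ℝ≥0∞, Measurable v ∧
        (∀ z, v z ≤ μHE[n - r] (B ∩ ξ ⁻¹' {z})) ∧
        (∀ z, μHE[n - r] (B ∩ ξ ⁻¹' {z}) ≤ a * v z) ∧
        ∫⁻ z, v z ≤ a * ∫⁻ x in B, ENNReal.ofReal (coareaFactor ξ x) ∧
        ∫⁻ x in B, ENNReal.ofReal (coareaFactor ξ x) ≤ a * ∫⁻ z, v z := by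
  set L := fderiv ℝ ξ x₀ with hL
  have hfin := finrank_ker_fderiv hdet
  rw [← hL] at hfin
  obtain ⟨e⟩ := exists_linearIsometryEquiv_prod L.ker hfin
  have hk : Module.finrank ℝ L.ker = n - r := by omega
  let P := L.ker.orthogonalProjectionOnto
  let F : EuclideanSpace ℝ (Fin n) → EuclideanSpace ℝ (Fin n) := fun x =>
    e (WithLp.toLp 2 (ξ x, P x))
  let F' := fun x => straighten (fderiv ℝ ξ x) L.ker e
  let ι : EuclideanSpace ℝ (Fin r) × L.ker →L[ℝ] EuclideanSpace ℝ (Fin n) :=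
    e.toContinuousLinearEquiv.toContinuousLinearMap ∘L
      (WithLp.prodContinuousLinearEquiv 2 ℝ
        (EuclideanSpace ℝ (Fin r)) L.ker).symm.toContinuousLinearMap
  have hcd : ∀ x ∈ U, ContDiffAt ℝ 1 ξ x := fun x hx => hξ.contDiffAt (hU.mem_nhds hx)
  have hF : ∀ x ∈ U, HasStrictFDerivAt F (F' x) x := fun x hx =>
    ι.hasStrictFDerivAt.comp x (((hcd x hx).hasStrictFDerivAt one_ne_zero).prodMk
      P.hasStrictFDerivAt)
  have hdet0 : |(F' x₀).det| = coareaFactor ξ x₀ := by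
    have := abs_det_straighten L e
    rw [coareaFactor, det_gramMatrix_eq_normDet_sq, Real.sqrt_sq (LinearMap.normDet_nonneg _)]
    exact this
  have hJ0 : 0 < coareaFactor ξ x₀ :=
    Real.sqrt_pos.2 (lt_of_le_of_ne (det_gramMatrix_nonneg ξ x₀) hdet.symm)
  have hD0 : (F' x₀).det ≠ 0 := fun h => by rw [h, abs_zero] at hdet0; exact hJ0.ne hdet0
  let D := (F' x₀).toContinuousLinearEquivOfDetNeZero hD0
  have hDF : ∀ v, D v = F' x₀ v := fun v => rfl
  -- constants
  obtain ⟨b, hb1, hba⟩ : ∃ b : ℝ≥0, 1 < b ∧ b ^ (n - r) ≤ a := by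
    have hc : Filter.Tendsto (fun b : ℝ≥0 => b ^ (n - r)) (nhdsWithin 1 (Set.Ioi 1)) (nhds 1) := by
      have : Filter.Tendsto (fun b : ℝ≥0 => b ^ (n - r)) (nhds 1) (nhds (1 ^ (n - r))) :=
        (continuous_pow _).tendsto _
      rw [one_pow] at this
      exact this.mono_left nhdsWithin_le_nhds
    obtain ⟨b, h1, h2⟩ := ((hc.eventually (gt_mem_nhds ha)).and self_mem_nhdsWithin).exists
    exact ⟨b, h2, h1.le⟩
  have hb0 : (0 : ℝ) < b := by
    have : (0 : ℝ≥0) < b := lt_trans zero_lt_one hb1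
    exact_mod_cast this
  have hb1' : (1 : ℝ) < b := by exact_mod_cast hb1
  -- The summand 1 keeps `N` positive. The linearization error `c` below satisfies `N * c = 1 - 1 /
  -- b`, so that it can be absorbed into the left side with loss exactly `b`.
  let N : ℝ := ‖(D.symm : EuclideanSpace ℝ (Fin n) →L[ℝ] EuclideanSpace ℝ (Fin n))‖ + 1
  have hN : 0 < N := by positivity
  have hc0 : 0 < (1 - 1 / (b : ℝ)) / N := by
    refine div_pos ?_ hN
    rw [sub_pos, div_lt_one hb0]; exact hb1'
  let c : ℝ≥0 := ⟨(1 - 1 / (b : ℝ)) / N, hc0.le⟩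
  obtain ⟨V₁, hV₁, happ⟩ := (hF x₀ hx₀).approximates_deriv_on_nhds (c := c) (Or.inr hc0)
  -- near `x₀` the determinant is close to the coarea factor
  have hcJ : ContinuousOn (coareaFactor ξ) U :=
    (continuousOn_det_gramMatrix hU hξ).sqrt
  have hcF : ContinuousOn (fun x => |(F' x).det|) U := by
    have h1 := hξ.continuousOn_fderiv_of_isOpen hU le_rfl
    have h2 : ContinuousOn F' U := by
      have h3 : ContinuousOn (fun x => (fderiv ℝ ξ x).prod P) U :=
        (ContinuousLinearMap.prodₗᵢ ℝ).continuous.comp_continuousOn (h1.prodMk continuousOn_const)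
      exact (ContinuousLinearMap.compL ℝ _ _ _ ι).continuous.comp_continuousOn h3
    exact (ContinuousLinearMap.continuous_det.comp_continuousOn h2).abs
  have ha' : (1 : ℝ) < a := by exact_mod_cast ha
  have hev1 : ∀ᶠ x in nhds x₀, |(F' x).det| < a * coareaFactor ξ x := by
    refine ContinuousAt.eventually_lt (hcF.continuousAt (hU.mem_nhds hx₀))
      (continuousAt_const.mul (hcJ.continuousAt (hU.mem_nhds hx₀))) ?_
    rw [hdet0]; nlinarith
  have hev2 : ∀ᶠ x in nhds x₀, coareaFactor ξ x < a * |(F' x).det| := by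
    refine ContinuousAt.eventually_lt (hcJ.continuousAt (hU.mem_nhds hx₀))
      (continuousAt_const.mul (hcF.continuousAt (hU.mem_nhds hx₀))) ?_
    rw [hdet0]; nlinarith
  obtain ⟨V, hVsub, hVo, hxV⟩ := mem_nhds_iff.1 (Filter.inter_mem
    (Filter.inter_mem hV₁ (hU.mem_nhds hx₀)) (hev1.and hev2))
  have hVU : V ⊆ U := fun x hx => (hVsub hx).1.2
  have hdist : ∀ x ∈ V, ∀ y ∈ V, ‖x - y‖ ≤ b * ‖D.symm (F x - F y)‖ := by
    intro x hx y hy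
    have h1 := happ x (hVsub hx).1.1 y (hVsub hy).1.1
    have h2 : x - y = D.symm (F x - F y) - D.symm (F x - F y - F' x₀ (x - y)) := by
      rw [← map_sub, sub_sub_cancel, ← hDF, D.symm_apply_apply]
    have h3 : ‖D.symm (F x - F y - F' x₀ (x - y))‖ ≤ N * (c * ‖x - y‖) := by
      refine ((D.symm : EuclideanSpace ℝ (Fin n) →L[ℝ] EuclideanSpace ℝ (Fin n)).le_opNorm
        _).trans ?_
      exact mul_le_mul (by simp [N]) h1 (norm_nonneg _) hN.le
    have h4 : N * (c * ‖x - y‖) = (1 - 1 / b) * ‖x - y‖ := by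
      change N * (((1 - 1 / (b : ℝ)) / N) * ‖x - y‖) = _
      field_simp
    have h5 : ‖x - y‖ ≤ ‖D.symm (F x - F y)‖ + (1 - 1 / b) * ‖x - y‖ := by
      rw [← h4]
      refine le_trans ?_ (add_le_add_right h3 _)
      conv_lhs => rw [h2]
      exact norm_sub_le _ _
    have h6 : ‖x - y‖ / b ≤ ‖D.symm (F x - F y)‖ := by
      have : (1 - 1 / b) * ‖x - y‖ = ‖x - y‖ - ‖x - y‖ / b := by ring
      linarith
    rw [div_le_iff₀ hb0] at h6
    linarith
  have hinj : Set.InjOn F V := by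
    intro x hx y hy hxy
    have := hdist x hx y hy
    rw [hxy, sub_self, map_zero, norm_zero, mul_zero] at this
    exact sub_eq_zero.1 (norm_le_zero_iff.1 this)
  -- On a common level set the first component of `F x - F y` vanishes, and `D` sends `P (x - y)`,
  -- an element of `ker L`, to the same vector. Hence `D⁻¹ (F x - F y) = P (x - y)`.
  have hbilip : ∀ x ∈ V, ∀ y ∈ V, ξ x = ξ y → dist x y ≤ b * dist (P x) (P y) := by
    intro x hx y hy hxy
    have h1 := hdist x hx y hy
    have h2 : D.symm (F x - F y) = (P (x - y) : EuclideanSpace ℝ (Fin n)) := by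
      rw [ContinuousLinearEquiv.symm_apply_eq, hDF]
      change F x - F y = straighten L L.ker e _
      rw [straighten_apply]
      change e (WithLp.toLp 2 (ξ x, P x)) - e (WithLp.toLp 2 (ξ y, P y)) = _
      rw [← map_sub, ← WithLp.toLp_sub, Prod.mk_sub_mk, hxy, sub_self,
        show L (P (x - y) : EuclideanSpace ℝ (Fin n)) = 0 from (P (x - y)).2,
        Submodule.orthogonalProjectionOnto_mem_subspace_eq_self, map_sub]
    rw [h2] at h1
    rw [dist_eq_norm, dist_eq_norm, ← map_sub]
    exact h1
  refine ⟨V, hVo, hxV, hVU, ?_⟩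
  intro B hBV hB
  let Ψ : EuclideanSpace ℝ (Fin n) → EuclideanSpace ℝ (Fin r) × L.ker := fun x => (ξ x, P x)
  have hΨF : ∀ x, F x = ι (Ψ x) := fun x => rfl
  have hΨinj : Set.InjOn Ψ B := fun x hx y hy h =>
    hinj (hBV hx) (hBV hy) (by rw [hΨF, hΨF, h])
  have hΨc : ContinuousOn Ψ B :=
    (hξ.continuousOn.mono (hBV.trans hVU)).prodMk P.continuous.continuousOn
  -- Injective continuous images of Borel sets are Borel (Lusin–Souslin).
  have hΨB : MeasurableSet (Ψ '' B) := hB.image_of_continuousOn_injOn hΨc hΨinj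
  have hslice : ∀ z, Prod.mk z ⁻¹' (Ψ '' B) = P '' (B ∩ ξ ⁻¹' {z}) := by
    intro z
    ext w
    simp only [Set.mem_preimage, Set.mem_image, Set.mem_inter_iff, Set.mem_singleton_iff, Ψ,
      Prod.mk.injEq]
    grind
  have hvol : (volume : Measure L.ker) = μHE[n - r] := by
    rw [← hk, InnerProductSpace.euclideanHausdorffMeasure_eq_volume]
  -- Fubini over the slices; `ι` preserves volume since `e` is an isometry.
  have hFB : ∫⁻ z, volume (Prod.mk z ⁻¹' (Ψ '' B)) = volume (F '' B) := by
    rw [← Measure.prod_apply hΨB]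
    have hmp : MeasurePreserving ι (volume.prod volume) volume :=
      e.measurePreserving.comp (WithLp.volume_preserving_toLp _ _)
    have hιinj : Function.Injective ι := fun x y h => by
      have := e.injective h
      exact WithLp.toLp_injective 2 this
    have hFim : F '' B = ι '' (Ψ '' B) := by rw [Set.image_image]; rfl
    have hιB : MeasurableSet (ι '' (Ψ '' B)) :=
      hΨB.image_of_continuousOn_injOn ι.continuous.continuousOn hιinj.injOn
    rw [hFim, ← hmp.measure_preimage hιB.nullMeasurableSet, Set.preimage_image_eq _ hιinj]
  have hcov : ∫⁻ x in B, ENNReal.ofReal |(F' x).det| = volume (F '' B) :=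
    lintegral_abs_det_fderiv_eq_addHaar_image volume hB
      (fun x hx => (hF x (hVU (hBV hx))).hasFDerivAt.hasFDerivWithinAt) (hinj.mono hBV)
  refine ⟨fun z => volume (Prod.mk z ⁻¹' (Ψ '' B)), measurable_measure_prodMk_left hΨB,
    fun z => ?_, fun z => ?_, ?_, ?_⟩
  · change volume (Prod.mk z ⁻¹' (Ψ '' B)) ≤ _
    rw [hslice, hvol]
    refine euclideanHausdorffMeasure_image_le (LipschitzWith.lipschitzOnWith ?_) _
    refine LipschitzWith.of_dist_le_mul fun x y => ?_
    rw [NNReal.coe_one, one_mul, dist_eq_norm, dist_eq_norm, ← map_sub]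
    exact L.ker.norm_orthogonalProjectionOnto_apply_le _
  · change _ ≤ a * volume (Prod.mk z ⁻¹' (Ψ '' B))
    rw [hslice, hvol]
    refine (euclideanHausdorffMeasure_le_image (f := P) (b := b) ?_ _).trans ?_
    · rintro x ⟨hx, hxz⟩ y ⟨hy, hyz⟩
      exact hbilip x (hBV hx) y (hBV hy) (by rw [hxz, hyz])
    · gcongr
      exact_mod_cast hba
  · rw [hFB, ← hcov, ← lintegral_const_mul' _ _ ENNReal.coe_ne_top]
    refine setLIntegral_mono' hB fun x hx => ?_
    rw [← ENNReal.ofReal_coe_nnreal, ← ENNReal.ofReal_mul a.coe_nonneg]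
    exact ENNReal.ofReal_le_ofReal (hVsub (hBV hx)).2.1.le
  · rw [hFB, ← hcov, ← lintegral_const_mul' _ _ ENNReal.coe_ne_top]
    refine setLIntegral_mono' hB fun x hx => ?_
    rw [← ENNReal.ofReal_coe_nnreal, ← ENNReal.ofReal_mul a.coe_nonneg]
    exact ENNReal.ofReal_le_ofReal (hVsub (hBV hx)).2.2.le

end Local

/-! ### The coarea formula on the regular set. -/

section Coarea

variable {n r : ℕ}

/-- The regular points of `ξ` in `U`. -/
def regularSet (ξ : EuclideanSpace ℝ (Fin n) → EuclideanSpace ℝ (Fin r))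
    (U : Set (EuclideanSpace ℝ (Fin n))) : Set (EuclideanSpace ℝ (Fin n)) :=
  {x ∈ U | (gramMatrix ξ x).det ≠ 0}

variable {ξ : EuclideanSpace ℝ (Fin n) → EuclideanSpace ℝ (Fin r)}
  {U B : Set (EuclideanSpace ℝ (Fin n))}

theorem measurableSet_regularSet (hU : IsOpen U) : MeasurableSet (regularSet ξ U) :=
  hU.measurableSet.inter (measurable_det_gramMatrix ξ (measurableSet_singleton 0).compl)

theorem measurableSet_inter_level (hU : IsOpen U) (hξ : ContDiffOn ℝ 1 ξ U) (hBU : B ⊆ U)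
    (hB : MeasurableSet B) (z : EuclideanSpace ℝ (Fin r)) : MeasurableSet (B ∩ ξ ⁻¹' {z}) := by
  have h1 : MeasurableSet (U ∩ ξ ⁻¹' {z}ᶜ) :=
    (hξ.continuousOn.isOpen_inter_preimage hU isClosed_singleton.isOpen_compl).measurableSet
  have h2 : B ∩ ξ ⁻¹' {z} = B \ (U ∩ ξ ⁻¹' {z}ᶜ) := by
    ext x
    simp only [Set.mem_inter_iff, Set.mem_preimage, Set.mem_singleton_iff, Set.mem_sdiff,
      Set.mem_compl_iff]
    have := @hBU x
    tauto
  rw [h2]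
  exact hB.diff h1

/-- Lindelöf, then disjointification. The property is claimed for nonempty pieces only, because for
empty `R` the local hypothesis is vacuous. -/
theorem exists_partition_of_local {R : Set (EuclideanSpace ℝ (Fin n))} (hR : MeasurableSet R)
    {p : Set (EuclideanSpace ℝ (Fin n)) → Prop} (hp : ∀ s t, s ⊆ t → p t → p s)
    (hloc : ∀ x ∈ R, ∃ V, IsOpen V ∧ x ∈ V ∧ p V) :
    ∃ V : ℕ → Set (EuclideanSpace ℝ (Fin n)), (∀ i, MeasurableSet (V i)) ∧
      Pairwise (Function.onFun Disjoint V) ∧ ⋃ i, V i = R ∧ ∀ i, (V i).Nonempty → p (V i) := by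
  choose! V hVo hxV hpV using hloc
  obtain ⟨t, htR, htc, hcov⟩ := TopologicalSpace.countable_cover_nhdsWithin (s := R) (f := V)
    fun x hx => mem_nhdsWithin_of_mem_nhds ((hVo x hx).mem_nhds (hxV x hx))
  rcases R.eq_empty_or_nonempty with hRe | hRne
  · refine ⟨fun _ => ∅, fun _ => .empty, fun _ _ _ => by simp [Function.onFun], ?_, ?_⟩
    · simp [hRe]
    · simp
  have htne : t.Nonempty := by
    obtain ⟨x, hx⟩ := hRne
    obtain ⟨y, hy, -⟩ := Set.mem_iUnion₂.1 (hcov hx)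
    exact ⟨y, hy⟩
  obtain ⟨s, rfl⟩ := htc.exists_eq_range htne
  have hs : ∀ i, s i ∈ R := fun i => htR ⟨i, rfl⟩
  let W : ℕ → Set (EuclideanSpace ℝ (Fin n)) := fun i => V (s i) ∩ R
  refine ⟨disjointed W, MeasurableSet.disjointed fun i => (hVo _ (hs i)).measurableSet.inter hR,
    disjoint_disjointed W, ?_, fun i _ =>
      hp _ _ ((disjointed_subset W i).trans Set.inter_subset_left) (hpV _ (hs i))⟩
  rw [iUnion_disjointed]
  refine Set.Subset.antisymm (Set.iUnion_subset fun i => Set.inter_subset_right) fun x hx => ?_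
  obtain ⟨y, ⟨i, rfl⟩, hy⟩ := Set.mem_iUnion₂.1 (hcov hx)
  exact Set.mem_iUnion.2 ⟨i, hy, hx⟩

theorem exists_coarea_bounds (hU : IsOpen U) (hξ : ContDiffOn ℝ 1 ξ U)
    (hBR : B ⊆ regularSet ξ U) (hB : MeasurableSet B) {a : ℝ≥0} (ha : 1 < a) :
    ∃ v : EuclideanSpace ℝ (Fin r) → ℝ≥0∞, Measurable v ∧
      (∀ z, v z ≤ μHE[n - r] (B ∩ ξ ⁻¹' {z})) ∧
      (∀ z, μHE[n - r] (B ∩ ξ ⁻¹' {z}) ≤ a * v z) ∧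
      ∫⁻ z, v z ≤ a * ∫⁻ x in B, ENNReal.ofReal (coareaFactor ξ x) ∧
      ∫⁻ x in B, ENNReal.ofReal (coareaFactor ξ x) ≤ a * ∫⁻ z, v z := by
  obtain ⟨V, hV, hVd, hVU, hVp⟩ := exists_partition_of_local hB
    (p := fun V => ∀ B ⊆ V, MeasurableSet B →
      ∃ v : EuclideanSpace ℝ (Fin r) → ℝ≥0∞, Measurable v ∧
      (∀ z, v z ≤ μHE[n - r] (B ∩ ξ ⁻¹' {z})) ∧
      (∀ z, μHE[n - r] (B ∩ ξ ⁻¹' {z}) ≤ a * v z) ∧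
      ∫⁻ z, v z ≤ a * ∫⁻ x in B, ENNReal.ofReal (coareaFactor ξ x) ∧
      ∫⁻ x in B, ENNReal.ofReal (coareaFactor ξ x) ≤ a * ∫⁻ z, v z)
    (fun s t hst h B hB => h B (hB.trans hst))
    (fun x hx => by
      obtain ⟨V, h1, h2, -, h3⟩ := exists_nhd_coarea_bounds hU hξ (hBR hx).1 (hBR hx).2 ha
      exact ⟨V, h1, h2, h3⟩)
  have hex : ∀ i, ∃ v : EuclideanSpace ℝ (Fin r) → ℝ≥0∞, Measurable v ∧
      (∀ z, v z ≤ μHE[n - r] (V i ∩ ξ ⁻¹' {z})) ∧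
      (∀ z, μHE[n - r] (V i ∩ ξ ⁻¹' {z}) ≤ a * v z) ∧
      ∫⁻ z, v z ≤ a * ∫⁻ x in V i, ENNReal.ofReal (coareaFactor ξ x) ∧
      ∫⁻ x in V i, ENNReal.ofReal (coareaFactor ξ x) ≤ a * ∫⁻ z, v z := by
    intro i
    rcases (V i).eq_empty_or_nonempty with h | h
    · exact ⟨0, measurable_zero, by simp [h]⟩
    · exact hVp i h (V i) subset_rfl (hV i)
  choose v hvm hv1 hv2 hv3 hv4 using hex
  have hVB : ∀ i, V i ⊆ B := fun i => hVU ▸ Set.subset_iUnion V i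
  have hsum : ∀ z, μHE[n - r] (B ∩ ξ ⁻¹' {z}) = ∑' i, μHE[n - r] (V i ∩ ξ ⁻¹' {z}) := by
    intro z
    rw [← measure_iUnion, ← Set.iUnion_inter, hVU]
    · exact fun i j hij => (hVd hij).mono Set.inter_subset_left Set.inter_subset_left
    · exact fun i => measurableSet_inter_level hU hξ
        ((hVB i).trans fun x hx => (hBR hx).1) (hV i) z
  have hint : ∫⁻ x in B, ENNReal.ofReal (coareaFactor ξ x) =
      ∑' i, ∫⁻ x in V i, ENNReal.ofReal (coareaFactor ξ x) := by
    rw [← hVU, lintegral_iUnion hV hVd]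
  have hintv : ∫⁻ z, ∑' i, v i z = ∑' i, ∫⁻ z, v i z :=
    lintegral_tsum fun i => (hvm i).aemeasurable
  refine ⟨fun z => ∑' i, v i z, Measurable.tsum hvm, fun z => ?_, fun z => ?_, ?_, ?_⟩
  · rw [hsum]; exact ENNReal.tsum_le_tsum fun i => hv1 i z
  · rw [hsum, ← ENNReal.tsum_mul_left]; exact ENNReal.tsum_le_tsum fun i => hv2 i z
  · rw [hint, hintv, ← ENNReal.tsum_mul_left]; exact ENNReal.tsum_le_tsum hv3
  · rw [hint, hintv, ← ENNReal.tsum_mul_left]; exact ENNReal.tsum_le_tsum hv4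

theorem le_of_forall_le_mul_of_tendsto_one {u : ℕ → ℝ≥0∞}
    (hu : Filter.Tendsto u Filter.atTop (nhds 1)) {x y : ℝ≥0∞} (h : ∀ m, x ≤ u m * y) : x ≤ y := by
  have h1 : Filter.Tendsto (fun m => u m * y) Filter.atTop (nhds (1 * y)) :=
    ENNReal.Tendsto.mul_const hu (Or.inl one_ne_zero)
  rw [one_mul] at h1
  exact ge_of_tendsto' h1 h

/-- Coarea formula on the regular set, with the measurability of the integrand. -/
theorem measurable_lintegral_hausdorff_level (hU : IsOpen U) (hξ : ContDiffOn ℝ 1 ξ U)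
    (hBR : B ⊆ regularSet ξ U) (hB : MeasurableSet B) :
    Measurable (fun z => μHE[n - r] (B ∩ ξ ⁻¹' {z})) ∧
      ∫⁻ z, μHE[n - r] (B ∩ ξ ⁻¹' {z}) = ∫⁻ x in B, ENNReal.ofReal (coareaFactor ξ x) := by
  obtain ⟨u, -, hu1, hu⟩ := exists_seq_strictAnti_tendsto (1 : ℝ≥0)
  have hu' : Filter.Tendsto (fun m => (u m : ℝ≥0∞)) Filter.atTop (nhds 1) := by
    have := ENNReal.tendsto_coe.2 hu
    rwa [ENNReal.coe_one] at this
  choose v hvm hv1 hv2 hv3 hv4 using fun m => exists_coarea_bounds hU hξ hBR hB (hu1 m)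
  refine ⟨?_, le_antisymm ?_ ?_⟩
  -- The Hausdorff measure is squeezed between `v m z` and `u m * v m z` with `u m → 1`, hence is a
  -- countable infimum of measurable functions.
  · have : (fun z => μHE[n - r] (B ∩ ξ ⁻¹' {z})) = fun z => ⨅ m, u m * v m z := by
      ext z
      refine le_antisymm (le_iInf fun m => hv2 m z) ?_
      refine le_of_forall_le_mul_of_tendsto_one hu' fun m => (iInf_le _ m).trans ?_
      gcongr
      exact hv1 m z
    rw [this]
    exact Measurable.iInf fun m => (hvm m).const_mul _
  · have huu : Filter.Tendsto (fun m => (u m : ℝ≥0∞) * u m) Filter.atTop (nhds 1) := by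
      have := ENNReal.Tendsto.mul hu' (Or.inl one_ne_zero) hu' (Or.inl one_ne_zero)
      rwa [one_mul] at this
    refine le_of_forall_le_mul_of_tendsto_one huu fun m => ?_
    calc ∫⁻ z, μHE[n - r] (B ∩ ξ ⁻¹' {z}) ≤ ∫⁻ z, u m * v m z := lintegral_mono (hv2 m)
      _ = u m * ∫⁻ z, v m z := lintegral_const_mul _ (hvm m)
      _ ≤ u m * (u m * ∫⁻ x in B, ENNReal.ofReal (coareaFactor ξ x)) := by gcongr; exact hv3 m
      _ = _ := by ring
  · refine le_of_forall_le_mul_of_tendsto_one hu' fun m => (hv4 m).trans ?_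
    gcongr
    exact hv1 m _

/-- The Hausdorff measures on the regular parts of the level sets of `ξ`, as a kernel. -/
def levelKernel (hU : IsOpen U) (hξ : ContDiffOn ℝ 1 ξ U) :
    Kernel (EuclideanSpace ℝ (Fin r)) (EuclideanSpace ℝ (Fin n)) where
  toFun z := (μHE[n - r]).restrict (regularSet ξ U ∩ ξ ⁻¹' {z})
  measurable' := by
    refine Measure.measurable_of_measurable_coe _ fun B hB => ?_
    simp only [Measure.restrict_apply hB, ← Set.inter_assoc]
    exact (measurable_lintegral_hausdorff_level hU hξ Set.inter_subset_right
      (hB.inter (measurableSet_regularSet hU))).1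

theorem levelKernel_apply (hU : IsOpen U) (hξ : ContDiffOn ℝ 1 ξ U) (z) :
    levelKernel hU hξ z = (μHE[n - r]).restrict (regularSet ξ U ∩ ξ ⁻¹' {z}) := rfl

theorem bind_levelKernel (hU : IsOpen U) (hξ : ContDiffOn ℝ 1 ξ U) :
    volume.bind (levelKernel hU hξ) =
      (volume.restrict (regularSet ξ U)).withDensity fun x => ENNReal.ofReal (coareaFactor ξ x) := by
  ext B hB
  rw [Measure.bind_apply hB (Kernel.measurable _).aemeasurable, withDensity_apply _ hB,
    Measure.restrict_restrict hB, ← (measurable_lintegral_hausdorff_level hU hξ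
      Set.inter_subset_right (hB.inter (measurableSet_regularSet hU))).2]
  simp only [levelKernel_apply, Measure.restrict_apply hB, Set.inter_assoc]

theorem measurable_coareaFactor (ξ : EuclideanSpace ℝ (Fin n) → EuclideanSpace ℝ (Fin r)) :
    Measurable (coareaFactor ξ) := (measurable_det_gramMatrix ξ).sqrt

theorem coareaFactor_pos {x} (hx : x ∈ regularSet ξ U) : 0 < coareaFactor ξ x :=
  Real.sqrt_pos.2 (lt_of_le_of_ne (det_gramMatrix_nonneg ξ x) hx.2.symm)

theorem det_rpow_neg_half_eq_inv_coareaFactor (x) :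
    (gramMatrix ξ x).det ^ (-(1 / 2) : ℝ) = (coareaFactor ξ x)⁻¹ := by
  rw [Real.rpow_neg (det_gramMatrix_nonneg ξ x), coareaFactor, Real.sqrt_eq_rpow]

/-- The inverse coarea factor, which also occurs in the density of `μ_z`, cancels the Jacobian of
the coarea formula. -/
theorem lintegral_lintegral_levelKernel (hU : IsOpen U) (hξ : ContDiffOn ℝ 1 ξ U)
    {f : EuclideanSpace ℝ (Fin n) → ℝ≥0∞} (hf : Measurable f) :
    ∫⁻ z, ∫⁻ x, ENNReal.ofReal (coareaFactor ξ x)⁻¹ * f x ∂(levelKernel hU hξ z) =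
      ∫⁻ x in regularSet ξ U, f x := by
  have hm : Measurable fun x => ENNReal.ofReal (coareaFactor ξ x)⁻¹ * f x :=
    (measurable_coareaFactor ξ).inv.ennreal_ofReal.mul hf
  rw [← Measure.lintegral_bind (Kernel.measurable _).aemeasurable hm.aemeasurable,
    bind_levelKernel, lintegral_withDensity_eq_lintegral_mul _
      (measurable_coareaFactor ξ).ennreal_ofReal hm]
  refine setLIntegral_congr_fun (measurableSet_regularSet hU) fun x hx => ?_
  have h := coareaFactor_pos hx
  simp only [Pi.mul_apply]
  rw [← mul_assoc, ← ENNReal.ofReal_mul h.le, mul_inv_cancel₀ h.ne', ENNReal.ofReal_one, one_mul]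

end Coarea

/-! ### Disintegration of the stationary measure on a Lebesgue measurable `X`. -/

section Subset

variable {n r : ℕ} {X : Set (EuclideanSpace ℝ (Fin n))}

/-- `X` is only null measurable, so measures are carried from the ambient space to `X` by a
retraction that is the identity on a Borel subset of full measure. -/
theorem exists_measurable_retraction {X₀ : Set (EuclideanSpace ℝ (Fin n))} (hne : Nonempty X)
    (h₀ : MeasurableSet X₀) (h₀X : X₀ ⊆ X) :
    ∃ j : EuclideanSpace ℝ (Fin n) → X, Measurable j ∧ ∀ x ∈ X₀, (j x : EuclideanSpace ℝ _) = x := by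
  classical
  let x₁ : X := hne.some
  refine ⟨fun x => ⟨if x ∈ X₀ then x else x₁, ?_⟩, ?_, fun x hx => by simp [hx]⟩
  · split_ifs with h
    · exact h₀X h
    · exact x₁.2
  · exact Measurable.subtype_mk (Measurable.ite h₀ measurable_id measurable_const)

theorem lebesgueOn_eq_map {X₀ : Set (EuclideanSpace ℝ (Fin n))} (hX : NullMeasurableSet X volume)
    (h₀ae : X₀ =ᵐ[volume] X)
    {j : EuclideanSpace ℝ (Fin n) → X} (hj : Measurable j)
    (hjX : ∀ x ∈ X₀, (j x : EuclideanSpace ℝ (Fin n)) = x) :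
    lebesgueOn X = (volume.restrict X₀).map j := by
  have himg : ∀ s : Set X, MeasurableSet s →
      NullMeasurableSet (Subtype.val '' s : Set (EuclideanSpace ℝ (Fin n))) volume := by
    rintro _ ⟨t, ht, rfl⟩
    rw [Subtype.image_preimage_coe]
    exact hX.inter ht.nullMeasurableSet
  ext B hB
  rw [lebesgueOn, Measure.comap_apply₀ _ _ Subtype.val_injective himg hB.nullMeasurableSet,
    Measure.map_apply hj hB, Measure.restrict_apply (hj hB)]
  refine measure_congr ?_
  filter_upwards [h₀ae.mem_iff] with x hx
  refine propext ⟨?_, ?_⟩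
  · rintro ⟨y, hy, rfl⟩
    have h1 : (y : EuclideanSpace ℝ (Fin n)) ∈ X₀ := hx.2 y.2
    refine ⟨?_, h1⟩
    change j y ∈ B
    rwa [show j y = y from Subtype.ext (hjX _ h1)]
  · rintro ⟨h1, h2⟩
    exact ⟨j x, h1, hjX x h2⟩

theorem continuous_restrict_of_contDiffOn
    {ξ : EuclideanSpace ℝ (Fin n) → EuclideanSpace ℝ (Fin r)}
    {U : Set (EuclideanSpace ℝ (Fin n))} (hXU : X ⊆ U) (hξ : ContDiffOn ℝ 1 ξ U) :
    Continuous fun x : X => ξ x :=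
  continuousOn_iff_continuous_domRestrict.1 (hξ.continuousOn.mono hXU)

theorem measurable_marginal_density (S : MarkovSystem X)
    (ξ : EuclideanSpace ℝ (Fin n) → EuclideanSpace ℝ (Fin r)) :
    Measurable fun x : X => ENNReal.ofReal (S.π x * (gramMatrix ξ x).det ^ (-(1 / 2) : ℝ)) := by
  simp only [det_rpow_neg_half_eq_inv_coareaFactor]
  exact (S.continuous_π.measurable.mul
    ((measurable_coareaFactor ξ).comp measurable_subtype_coe).inv).ennreal_ofReal

theorem ae_marginal_mem_level (S : MarkovSystem X)
    {ξ : EuclideanSpace ℝ (Fin n) → EuclideanSpace ℝ (Fin r)} (hξ : Continuous fun x : X => ξ x)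
    (z : EuclideanSpace ℝ (Fin r)) : ∀ᵐ y : X ∂(S.marginal ξ z), ξ y = z := by
  have hm : MeasurableSet (levelSet X ξ z) := (isClosed_singleton.preimage hξ).measurableSet
  have h : ∀ᵐ y : X ∂((μHE[n - r] : Measure X).restrict (levelSet X ξ z)), ξ y = z :=
    ae_restrict_mem hm
  exact (withDensity_absolutelyContinuous _ _).ae_le h

theorem marginal_eq_zero (S : MarkovSystem X)
    {ξ : EuclideanSpace ℝ (Fin n) → EuclideanSpace ℝ (Fin r)} {Z : Set (EuclideanSpace ℝ (Fin r))}
    (hξZ : Set.MapsTo ξ X Z) {z : EuclideanSpace ℝ (Fin r)} (hz : z ∉ Z) :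
    S.marginal ξ z = 0 := by
  have : levelSet X ξ z = ∅ := by
    ext x
    simp only [levelSet, Set.mem_ofPred_eq, Set.mem_empty_iff_false, iff_false]
    rintro rfl
    exact hz (hξZ x.2)
  simp [MarkovSystem.marginal, this]

/-- The marginal measures form, up to a null set of parameters, a kernel which disintegrates the
stationary measure. -/
theorem exists_kernel_marginal (hX : NullMeasurableSet X volume) (S : MarkovSystem X)
    {Z : Set (EuclideanSpace ℝ (Fin r))} (hZ : MeasurableSet Z)
    {ξ : EuclideanSpace ℝ (Fin n) → EuclideanSpace ℝ (Fin r)}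
    {U : Set (EuclideanSpace ℝ (Fin n))} (hU : IsOpen U) (hXU : X ⊆ U)
    (hξ : ContDiffOn ℝ 1 ξ U) (hξZ : Set.MapsTo ξ X Z)
    (hreg : ∀ᵐ x : X ∂(lebesgueOn X), (gramMatrix ξ x).det ≠ 0) :
    ∃ κ : Kernel (EuclideanSpace ℝ (Fin r)) X,
      (∀ᵐ z ∂(volume.restrict Z), S.marginal ξ z = κ z) ∧
      ∀ f : X → ℝ≥0∞, Measurable f →
        ∫⁻ x, f x ∂S.μ = ∫⁻ z in Z, ∫⁻ x, f x ∂(κ z) := by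
  have hne : Nonempty X := by
    have := S.isProbabilityMeasure_π
    exact nonempty_of_isProbabilityMeasure (densityMeasure S.π)
  obtain ⟨X₀, h₀X, h₀, h₀ae⟩ := hX.exists_measurable_subset_ae_eq
  obtain ⟨j, hj, hjX⟩ := exists_measurable_retraction hne h₀ h₀X
  have hleb := lebesgueOn_eq_map hX h₀ae hj hjX
  let g : X → ℝ≥0∞ := fun x => ENNReal.ofReal (S.π x * (gramMatrix ξ x).det ^ (-(1 / 2) : ℝ))
  have hg : Measurable g := measurable_marginal_density S ξ
  let η := levelKernel hU hξ
  have hint : ∀ (f : X → ℝ≥0∞), Measurable f → ∀ z,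
      ∫⁻ x, f x ∂((((η z).restrict X₀).map j).withDensity g) =
        ∫⁻ x in X₀, g (j x) * f (j x) ∂(η z) := by
    intro f hf z
    rw [lintegral_withDensity_eq_lintegral_mul _ hg hf, lintegral_map (hg.mul hf) hj]
    rfl
  let κ : Kernel (EuclideanSpace ℝ (Fin r)) X :=
    { toFun := fun z => (((η z).restrict X₀).map j).withDensity g
      measurable' := by
        refine Measure.measurable_of_measurable_coe _ fun B hB => ?_
        have : ∀ z, (((η z).restrict X₀).map j).withDensity g B =
            ∫⁻ x in X₀, g (j x) * B.indicator 1 (j x) ∂(η z) := by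
          intro z
          rw [← hint _ (measurable_one.indicator hB), lintegral_indicator_one hB]
        simp only [this, ← lintegral_indicator h₀]
        exact Measurable.lintegral_kernel
          (((hg.comp hj).mul ((measurable_one.indicator hB).comp hj)).indicator h₀) }
  have hκ : ∀ z, κ z = (((η z).restrict X₀).map j).withDensity g := fun z => rfl
  have hN : volume (toMeasurable volume (X \ X₀)) = 0 := by
    rw [measure_toMeasurable]
    exact (ae_le_set.1 h₀ae.symm.le)
  have hae : ∀ᵐ z ∂volume, S.marginal ξ z = κ z := by
    -- By the coarea formula, a volume-null set meets the regular part of almost every level set in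
    -- a Hausdorff-null set. So discarding `X \ X₀` leaves almost every `μ_z` unchanged.
    have h1 : ∫⁻ z, η z (toMeasurable volume (X \ X₀)) = 0 := by
      rw [← Measure.bind_apply (measurableSet_toMeasurable _ _) (Kernel.measurable _).aemeasurable,
        bind_levelKernel]
      refine (withDensity_absolutelyContinuous _ _) ?_
      exact Measure.absolutelyContinuous_of_le Measure.restrict_le_self hN
    rw [lintegral_eq_zero_iff (Kernel.measurable_coe _ (measurableSet_toMeasurable _ _))] at h1
    filter_upwards [h1] with z hz
    have hregm : MeasurableSet {x : X | (gramMatrix ξ x).det ≠ 0} :=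
      ((measurable_det_gramMatrix ξ).comp measurable_subtype_coe)
        (measurableSet_singleton 0).compl
    -- At critical points `0 ^ (-(1 / 2))` is `0`, so the marginal measure does not see them.
    have hgind : g = Set.indicator {x : X | (gramMatrix ξ x).det ≠ 0} g := by
      ext x
      by_cases hx : (gramMatrix ξ x).det = 0
      · simp [g, hx]
      · simp [hx]
    have h2 : S.marginal ξ z = ((μHE[n - r]).restrict
        ({x : X | (gramMatrix ξ x).det ≠ 0} ∩ levelSet X ξ z)).withDensity g := by
      rw [← Measure.restrict_restrict hregm, ← withDensity_indicator hregm, ← hgind]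
      rfl
    rw [h2, hκ]
    congr 1
    ext B hB
    rw [Measure.restrict_apply hB, Measure.map_apply hj hB, Measure.restrict_apply (hj hB),
      ← isometry_subtype_coe.euclideanHausdorffMeasure_image, levelKernel_apply,
      Measure.restrict_apply ((hj hB).inter h₀)]
    rw [levelKernel_apply, Measure.restrict_apply (measurableSet_toMeasurable _ _)] at hz
    refine le_antisymm ?_ (measure_mono ?_)
    · refine (measure_mono ?_).trans ((measure_union_le _ _).trans_eq
        ((congrArg _ hz).trans (add_zero _)))
      rintro _ ⟨x, ⟨hxB, hxr, hxz⟩, rfl⟩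
      have hxR : (x : EuclideanSpace ℝ (Fin n)) ∈ regularSet ξ U ∩ ξ ⁻¹' {z} :=
        ⟨⟨hXU x.2, hxr⟩, hxz⟩
      by_cases hx0 : (x : EuclideanSpace ℝ (Fin n)) ∈ X₀
      · refine Or.inl ⟨⟨?_, hx0⟩, hxR⟩
        change j x ∈ B
        rwa [show j x = x from Subtype.ext (hjX _ hx0)]
      · exact Or.inr ⟨subset_toMeasurable _ _ ⟨x.2, hx0⟩, hxR⟩
    · rintro x ⟨⟨hxB, hx0⟩, hxR, hxz⟩
      refine ⟨j x, ⟨hxB, ?_, ?_⟩, hjX x hx0⟩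
      · change (gramMatrix ξ (j x)).det ≠ 0
        rw [hjX x hx0]; exact hxR.2
      · change ξ (j x) = z
        rw [hjX x hx0]; exact hxz
  refine ⟨κ, ae_restrict_of_ae hae, fun f hf => ?_⟩
  -- The level sets outside `Z` are empty.
  have hZint : ∫⁻ z in Z, ∫⁻ x, f x ∂(κ z) = ∫⁻ z, ∫⁻ x, f x ∂(κ z) := by
    rw [← lintegral_indicator hZ]
    refine lintegral_congr_ae ?_
    filter_upwards [hae] with z hz
    by_cases hzZ : z ∈ Z
    · simp [hzZ]
    · simp [hzZ, ← hz, marginal_eq_zero S hξZ hzZ]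
  have hpf : Measurable fun x => X₀.indicator (fun x => ENNReal.ofReal (S.π (j x)) * f (j x)) x :=
    (((S.continuous_π.measurable.comp hj).ennreal_ofReal).mul (hf.comp hj)).indicator h₀
  rw [hZint]
  have h1 : ∀ z, ∫⁻ x, f x ∂(κ z) = ∫⁻ x, ENNReal.ofReal (coareaFactor ξ x)⁻¹ *
      X₀.indicator (fun x => ENNReal.ofReal (S.π (j x)) * f (j x)) x ∂(η z) := by
    intro z
    rw [hκ, hint f hf, ← lintegral_indicator h₀]
    refine lintegral_congr fun x => ?_
    by_cases hx : x ∈ X₀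
    · simp only [hx, Set.indicator_of_mem, g]
      rw [det_rpow_neg_half_eq_inv_coareaFactor, ENNReal.ofReal_mul (S.π_pos _).le, hjX x hx]
      ring
    · simp [hx]
  simp only [h1]
  rw [lintegral_lintegral_levelKernel hU hξ hpf, MarkovSystem.μ, densityMeasure,
    lintegral_withDensity_eq_lintegral_mul _ S.continuous_π.measurable.ennreal_ofReal hf, hleb,
    lintegral_map (S.continuous_π.measurable.ennreal_ofReal.mul hf) hj,
    setLIntegral_indicator h₀]
  have h2 : (X₀ ∩ regularSet ξ U : Set _) =ᵐ[volume] X₀ := by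
    rw [hleb] at hreg
    have h3 := (ae_restrict_iff' h₀).1 (ae_of_ae_map hj.aemeasurable hreg)
    filter_upwards [h3] with x hx
    refine propext ⟨fun h => h.1, fun h => ⟨h, hXU (h₀X h), ?_⟩⟩
    have := hx h
    rwa [hjX x h] at this
  rw [Measure.restrict_congr_set h2]
  rfl

end Subset

/-! ### Transition densities: reversibility and contraction in time. -/

namespace MarkovSystem

variable {n r : ℕ} {X : Set (EuclideanSpace ℝ (Fin n))} (S : MarkovSystem X)

theorem nonempty_space (S : MarkovSystem X) : Nonempty X := by
  have := S.isProbabilityMeasure_π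
  exact nonempty_of_isProbabilityMeasure (densityMeasure S.π)

instance : IsProbabilityMeasure S.μ := S.isProbabilityMeasure_π

theorem sFinite_lebesgueOn (S : MarkovSystem X) (hX : NullMeasurableSet X volume) : SFinite (lebesgueOn X) := by
  obtain ⟨X₀, h₀X, h₀, h₀ae⟩ := hX.exists_measurable_subset_ae_eq
  obtain ⟨j, hj, hjX⟩ := exists_measurable_retraction S.nonempty_space h₀ h₀X
  rw [lebesgueOn_eq_map hX h₀ae hj hjX]
  infer_instance

theorem lintegral_μ {f : X → ℝ≥0∞} (hf : Measurable f) :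
    ∫⁻ x, f x ∂S.μ = ∫⁻ x, ENNReal.ofReal (S.π x) * f x ∂(lebesgueOn X) :=
  lintegral_withDensity_eq_lintegral_mul _ S.continuous_π.measurable.ennreal_ofReal hf

theorem μ_absolutelyContinuous : S.μ ≪ lebesgueOn X := withDensity_absolutelyContinuous _ _

theorem lebesgueOn_absolutelyContinuous : lebesgueOn X ≪ S.μ :=
  withDensity_absolutelyContinuous' S.continuous_π.measurable.ennreal_ofReal.aemeasurable
    (Filter.Eventually.of_forall fun x => by simpa using S.π_pos x)

variable {S} {t : ℝ}

theorem div_π_eq (ht : 0 < t) (x y : X) : S.p t x y / S.π y = S.p t y x / S.π x := by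
  rw [div_eq_div_iff (S.π_pos y).ne' (S.π_pos x).ne', S.detailed_balance t ht]

theorem measurable_div_π (ht : 0 < t) :
    Measurable fun q : X × X => S.p t q.1 q.2 / S.π q.2 :=
  (S.measurable_p t ht).div (S.continuous_π.measurable.comp measurable_snd)

theorem measurable_p_right (ht : 0 < t) (x : X) : Measurable (S.p t x) :=
  (S.measurable_p t ht).of_uncurry_left

theorem observableDist_eq_lintegral (y₁ y₂ : X) :
    S.observableDist t y₁ y₂ =
      ∫⁻ x, ‖S.p t x y₁ / S.π y₁ - S.p t x y₂ / S.π y₂‖ₑ ∂S.μ := by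
  rw [observableDist, eLpNorm_one_eq_lintegral_enorm]

theorem observableDist_comm (y₁ y₂ : X) :
    S.observableDist t y₁ y₂ = S.observableDist t y₂ y₁ := by
  simp only [observableDist_eq_lintegral, enorm_sub_rev]

/-- Splitting into positive parts allows contraction to be proved by truncated subtraction in
`ℝ≥0∞`, without integrability conditions. -/
theorem enorm_sub_eq_add_tsub {a b : ℝ} (ha : 0 ≤ a) (hb : 0 ≤ b) :
    ‖a - b‖ₑ = (ENNReal.ofReal a - ENNReal.ofReal b) + (ENNReal.ofReal b - ENNReal.ofReal a) := by
  rw [← ENNReal.ofReal_sub _ hb, ← ENNReal.ofReal_sub _ ha, Real.enorm_eq_ofReal_abs]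
  rcases le_total a b with h | h
  · rw [abs_of_nonpos (sub_nonpos.2 h), ENNReal.ofReal_of_nonpos (sub_nonpos.2 h), zero_add,
      neg_sub]
  · rw [abs_of_nonneg (sub_nonneg.2 h), ENNReal.ofReal_of_nonpos (sub_nonpos.2 h), add_zero]

/-- By reversibility, the distance of two observables is the total variation distance of the
transition probabilities. -/
theorem observableDist_eq_add (ht : 0 < t) (y₁ y₂ : X) :
    S.observableDist t y₁ y₂ =
      (∫⁻ x, (ENNReal.ofReal (S.p t y₁ x) - ENNReal.ofReal (S.p t y₂ x)) ∂(lebesgueOn X)) +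
      ∫⁻ x, (ENNReal.ofReal (S.p t y₂ x) - ENNReal.ofReal (S.p t y₁ x)) ∂(lebesgueOn X) := by
  have hm := fun y => (measurable_p_right (S := S) ht y)
  have hsub : Measurable fun x => ENNReal.ofReal (S.p t y₁ x) - ENNReal.ofReal (S.p t y₂ x) :=
    (hm y₁).ennreal_ofReal.sub (hm y₂).ennreal_ofReal
  rw [observableDist_eq_lintegral, ← lintegral_add_left hsub]
  simp only [div_π_eq ht _ y₁, div_π_eq ht _ y₂]
  rw [lintegral_μ]
  · refine lintegral_congr fun x => ?_
    rw [← enorm_sub_eq_add_tsub (S.p_nonneg t ht _ _) (S.p_nonneg t ht _ _), ← sub_div,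
      ← Real.enorm_of_nonneg (S.π_pos x).le, ← enorm_mul, mul_div_cancel₀ _ (S.π_pos x).ne']
  · exact (((hm y₁).div S.continuous_π.measurable).sub
      ((hm y₂).div S.continuous_π.measurable)).enorm

theorem lintegral_p (ht : 0 < t) (x : X) :
    ∫⁻ y, ENNReal.ofReal (S.p t x y) ∂(lebesgueOn X) = 1 := by
  have := S.isMarkovKernel_P t ht
  have h := measure_univ (μ := S.P t x)
  rwa [S.P_eq_density t ht, densityMeasure, withDensity_apply _ .univ, Measure.restrict_univ] at h

theorem observableDist_le_two (ht : 0 < t) (y₁ y₂ : X) : S.observableDist t y₁ y₂ ≤ 2 := by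
  rw [observableDist_eq_add ht]
  refine (add_le_add ?_ ?_).trans_eq one_add_one_eq_two
  · exact (lintegral_mono fun x => tsub_le_self).trans_eq (lintegral_p ht y₁)
  · exact (lintegral_mono fun x => tsub_le_self).trans_eq (lintegral_p ht y₂)

theorem p_add_ae_eq [SFinite (lebesgueOn X)] {s : ℝ} (hs : 0 < s) (ht : 0 < t) (y : X) :
    (fun x => ENNReal.ofReal (S.p (s + t) y x)) =ᵐ[lebesgueOn X] fun x =>
      ∫⁻ w, ENNReal.ofReal (S.p s y w) * ENNReal.ofReal (S.p t w x) ∂(lebesgueOn X) := by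
  have hst : 0 < s + t := add_pos hs ht
  have hm1 := (measurable_p_right (S := S) hst y).ennreal_ofReal
  have hm2 : Measurable fun q : X × X =>
      ENNReal.ofReal (S.p s y q.1) * ENNReal.ofReal (S.p t q.1 q.2) :=
    ((measurable_p_right hs y).comp measurable_fst).ennreal_ofReal.mul
      (S.measurable_p t ht).ennreal_ofReal
  -- Both sides are densities of the same measure, by Chapman–Kolmogorov and Tonelli; finite total
  -- mass makes the density unique almost everywhere.
  refine (withDensity_eq_iff hm1.aemeasurable hm2.lintegral_prod_left'.aemeasurable
    (by rw [lintegral_p hst]; exact ENNReal.one_ne_top)).1 ?_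
  have h1 := S.P_eq_density (s + t) hst y
  rw [densityMeasure] at h1
  rw [← h1, S.chapman_kolmogorov s t hs ht]
  ext B hB
  rw [Kernel.comp_apply' _ _ _ hB, withDensity_apply _ hB, S.P_eq_density s hs, densityMeasure,
    lintegral_withDensity_eq_lintegral_mul _ (measurable_p_right hs y).ennreal_ofReal
      (Kernel.measurable_coe _ hB), lintegral_lintegral_swap]
  · refine lintegral_congr fun w => ?_
    rw [Pi.mul_apply, S.P_eq_density t ht, densityMeasure, withDensity_apply _ hB]
    exact (lintegral_const_mul _ (measurable_p_right ht w).ennreal_ofReal).symm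
  · exact (hm2.comp measurable_swap).aemeasurable

/-- The positive part of a difference pushed through a kernel is at most the pushed positive part,
and pushing by a Markov kernel preserves mass. -/
theorem lintegral_tsub_le [SFinite (lebesgueOn X)] {s : ℝ} (hs : 0 < s) (ht : 0 < t) (y₁ y₂ : X) :
    ∫⁻ x, (ENNReal.ofReal (S.p (s + t) y₁ x) - ENNReal.ofReal (S.p (s + t) y₂ x)) ∂(lebesgueOn X) ≤
      ∫⁻ x, (ENNReal.ofReal (S.p s y₁ x) - ENNReal.ofReal (S.p s y₂ x)) ∂(lebesgueOn X) := by
  have hm := fun y => (measurable_p_right (S := S) hs y).ennreal_ofReal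
  have hmt := fun y => (measurable_p_right (S := S) ht y).ennreal_ofReal
  have hmt' := fun x => ((S.measurable_p t ht).of_uncurry_right (y := x)).ennreal_ofReal
  have hmt2 := (S.measurable_p t ht).ennreal_ofReal
  calc _ ≤ ∫⁻ x, ∫⁻ w, (ENNReal.ofReal (S.p s y₁ w) - ENNReal.ofReal (S.p s y₂ w)) *
        ENNReal.ofReal (S.p t w x) ∂(lebesgueOn X) ∂(lebesgueOn X) := by
        refine lintegral_mono_ae ?_
        filter_upwards [p_add_ae_eq hs ht y₁, p_add_ae_eq hs ht y₂] with x h1 h2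
        have hsub : Measurable fun w => (ENNReal.ofReal (S.p s y₁ w) -
            ENNReal.ofReal (S.p s y₂ w)) * ENNReal.ofReal (S.p t w x) :=
          ((hm y₁).sub (hm y₂)).mul (hmt' x)
        rw [h1, h2, tsub_le_iff_right, ← lintegral_add_left hsub]
        refine lintegral_mono fun w => ?_
        rw [← add_mul]
        gcongr
        exact le_tsub_add
    _ = ∫⁻ w, ∫⁻ x, (ENNReal.ofReal (S.p s y₁ w) - ENNReal.ofReal (S.p s y₂ w)) *
        ENNReal.ofReal (S.p t w x) ∂(lebesgueOn X) ∂(lebesgueOn X) := by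
        refine lintegral_lintegral_swap (Measurable.aemeasurable ?_)
        exact (((hm y₁).sub (hm y₂)).comp measurable_snd).mul (hmt2.comp measurable_swap)
    _ = _ := by
        refine lintegral_congr fun w => ?_
        rw [lintegral_const_mul _ (hmt w), lintegral_p ht, mul_one]

theorem observableDist_antitone [SFinite (lebesgueOn X)] {s : ℝ} (hs : 0 < s) (hst : s ≤ t)
    (y₁ y₂ : X) : S.observableDist t y₁ y₂ ≤ S.observableDist s y₁ y₂ := by
  rcases hst.eq_or_lt with rfl | hlt
  · rfl
  obtain ⟨u, hu, rfl⟩ : ∃ u, 0 < u ∧ t = s + u := ⟨t - s, sub_pos.2 hlt, by ring⟩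
  rw [observableDist_eq_add (add_pos hs hu), observableDist_eq_add hs]
  exact add_le_add (lintegral_tsub_le hs hu _ _) (lintegral_tsub_le hs hu _ _)

end MarkovSystem

/-! ### Normalized kernels and the distance to a mean. -/

section Normalize

variable {α β : Type*} [MeasurableSpace α] [MeasurableSpace β]

/-- The normalization of a kernel; it is `0` where the kernel is `0` or infinite. -/
def normalizedKernel (κ : Kernel α β) : Kernel α β where
  toFun a := (κ a Set.univ)⁻¹ • κ a
  measurable' := Measure.measurable_of_measurable_coe _ fun _ hB =>
    (κ.measurable_coe .univ).inv.mul (κ.measurable_coe hB)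

theorem normalizedKernel_apply (κ : Kernel α β) (a : α) :
    normalizedKernel κ a = (κ a Set.univ)⁻¹ • κ a := rfl

theorem normalizedKernel_univ_le (κ : Kernel α β) (a : α) :
    normalizedKernel κ a Set.univ ≤ 1 := by
  rw [normalizedKernel_apply, Measure.smul_apply, smul_eq_mul]
  exact ENNReal.inv_mul_le_one _

instance (κ : Kernel α β) : IsFiniteKernel (normalizedKernel κ) :=
  ⟨1, ENNReal.one_lt_top, normalizedKernel_univ_le κ⟩

/-- No integrability of `f` is needed: if it fails, the right side is infinite. -/
theorem enorm_sub_integral_le {μ : Measure β} [IsProbabilityMeasure μ] {f : β → ℝ}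
    (hf : Measurable f) (c : ℝ) : ‖c - ∫ y, f y ∂μ‖ₑ ≤ ∫⁻ y, ‖c - f y‖ₑ ∂μ := by
  by_cases hi : ∫⁻ y, ‖c - f y‖ₑ ∂μ = ∞
  · rw [hi]; exact le_top
  have h1 : Integrable (fun y => c - f y) μ :=
    ⟨(measurable_const.sub hf).aestronglyMeasurable, lt_of_le_of_ne le_top hi⟩
  have h2 : Integrable f μ := by
    have := (integrable_const c).sub h1
    exact this.congr (Filter.Eventually.of_forall fun y => by simp)
  have h3 : c - ∫ y, f y ∂μ = ∫ y, (c - f y) ∂μ := by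
    rw [integral_sub (integrable_const c) h2, integral_const]; simp
  rw [h3]
  exact enorm_integral_le_lintegral_enorm _

end Normalize

variable {n r : ℕ} {X : Set (EuclideanSpace ℝ (Fin n))}

/-! ### Comparing the two notions along the disintegration. -/

namespace MarkovSystem

/-- The kernel `κ` disintegrates the stationary measure along `ξ`, with respect to `ρ`, and it is
almost everywhere given by the marginal measures. -/
structure IsDisintegration (S : MarkovSystem X)
    (ξ : EuclideanSpace ℝ (Fin n) → EuclideanSpace ℝ (Fin r))
    (ρ : Measure (EuclideanSpace ℝ (Fin r))) (κ : Kernel (EuclideanSpace ℝ (Fin r)) X) : Prop where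
  continuous : Continuous fun x : X => ξ x
  marginal_ae_eq : ∀ᵐ z ∂ρ, S.marginal ξ z = κ z
  lintegral_eq : ∀ f : X → ℝ≥0∞, Measurable f → ∫⁻ x, f x ∂S.μ = ∫⁻ z, ∫⁻ x, f x ∂(κ z) ∂ρ

variable {S : MarkovSystem X} {t τ : ℝ}
  {ξ : EuclideanSpace ℝ (Fin n) → EuclideanSpace ℝ (Fin r)}
  {ρ : Measure (EuclideanSpace ℝ (Fin r))} {κ : Kernel (EuclideanSpace ℝ (Fin r)) X}

/-- The average distance of the observables on the level sets, integrated over the marginals. -/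
def avgDist (S : MarkovSystem X) (t : ℝ)
    (ξ : EuclideanSpace ℝ (Fin n) → EuclideanSpace ℝ (Fin r))
    (ρ : Measure (EuclideanSpace ℝ (Fin r))) : ℝ≥0∞ :=
  ∫⁻ z, ∫⁻ y₂, ⨍⁻ y₁, S.observableDist t y₁ y₂ ∂(S.marginal ξ z) ∂(S.marginal ξ z) ∂ρ

theorem avgDist_antitone [SFinite (lebesgueOn X)] (hτ : 0 < τ) (h : τ ≤ t) :
    S.avgDist t ξ ρ ≤ S.avgDist τ ξ ρ :=
  lintegral_mono fun _ => lintegral_mono fun _ => lintegral_mono fun _ =>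
    observableDist_antitone hτ h _ _

namespace IsDisintegration

variable (h : S.IsDisintegration ξ ρ κ)
include h

theorem avgDist_eq : S.avgDist t ξ ρ =
    ∫⁻ z, ∫⁻ y₂, ∫⁻ y₁, S.observableDist t y₁ y₂ ∂(normalizedKernel κ z) ∂(κ z) ∂ρ := by
  refine lintegral_congr_ae ?_
  filter_upwards [h.marginal_ae_eq] with z hz
  rw [hz]
  rfl

theorem lintegral_univ : ∫⁻ z, κ z Set.univ ∂ρ = 1 := by
  have := h.lintegral_eq 1 measurable_one
  simpa using this.symm

theorem ae_finite : ∀ᵐ z ∂ρ, κ z Set.univ < ∞ :=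
  ae_lt_top (κ.measurable_coe .univ) (by rw [h.lintegral_univ]; exact ENNReal.one_ne_top)

/-- This a priori bound supplies membership in `L¹` independently of any deflatability hypothesis.
-/
theorem avgDist_le_two (ht : 0 < t) : S.avgDist t ξ ρ ≤ 2 := by
  rw [h.avgDist_eq]
  calc _ ≤ ∫⁻ z, 2 * κ z Set.univ ∂ρ := by
        refine lintegral_mono fun z => ?_
        rw [← lintegral_const]
        refine lintegral_mono fun y₂ => ?_
        refine (lintegral_mono fun y₁ => observableDist_le_two ht y₁ y₂).trans ?_
        rw [lintegral_const]
        exact mul_le_of_le_one_right zero_le (normalizedKernel_univ_le κ z)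
    _ = 2 := by
        rw [lintegral_const_mul _ (κ.measurable_coe .univ), h.lintegral_univ, mul_one]

theorem ae_ae_of_ae {P : X → Prop} (hP : ∀ᵐ y ∂S.μ, P y) : ∀ᵐ z ∂ρ, ∀ᵐ y ∂(κ z), P y := by
  obtain ⟨N, hPN, hN, hN0⟩ := exists_measurable_superset_of_null (ae_iff.1 hP)
  have h1 := h.lintegral_eq _ (measurable_one.indicator hN)
  simp only [lintegral_indicator_one hN, hN0] at h1
  have h2 := (lintegral_eq_zero_iff (κ.measurable_coe hN)).1 h1.symm
  filter_upwards [h2] with z hz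
  exact ae_iff.2 (measure_mono_null hPN hz)

theorem ae_level : ∀ᵐ z ∂ρ, ∀ᵐ y : X ∂(κ z), ξ y = z := by
  filter_upwards [h.marginal_ae_eq] with z hz
  rw [← hz]
  exact ae_marginal_mem_level S h.continuous z

/-- `ξ` maps the stationary measure to a measure absolutely continuous with respect to `ρ`. -/
theorem ae_of_ae {P : EuclideanSpace ℝ (Fin r) → Prop} (hP : ∀ᵐ z ∂ρ, P z) :
    ∀ᵐ y : X ∂(lebesgueOn X), P (ξ y) := by
  refine S.lebesgueOn_absolutelyContinuous.ae_le ?_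
  obtain ⟨N, hPN, hN, hN0⟩ := exists_measurable_superset_of_null (ae_iff.1 hP)
  have hm : MeasurableSet ((fun x : X => ξ x) ⁻¹' N) := h.continuous.measurable hN
  have h1 := h.lintegral_eq _ (measurable_one.indicator hm)
  simp only [lintegral_indicator_one hm] at h1
  have h2 : ∫⁻ z, κ z ((fun x : X => ξ x) ⁻¹' N) ∂ρ = 0 := by
    rw [lintegral_eq_zero_iff (κ.measurable_coe hm)]
    -- For `z ∉ N`, the measure `κ z` lives on the level set of `z`, which misses the preimage of
    -- `N`.
    filter_upwards [h.ae_level, measure_eq_zero_iff_ae_notMem.1 hN0] with z hz hzN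
    refine measure_eq_zero_iff_ae_notMem.2 ?_
    filter_upwards [hz] with y hy
    rw [Set.mem_preimage, hy]
    exact hzN
  rw [h2] at h1
  exact ae_iff.2 (measure_mono_null (fun y hy => hPN hy) h1)

/-- Deflatability controls the average distance of the observables on level sets. -/
theorem avgDist_le [SFinite (lebesgueOn X)]
    {f : X → EuclideanSpace ℝ (Fin r) → ℝ}
    (hf : AEStronglyMeasurable (fun q : X × X => S.p t q.1 q.2 - f q.1 (ξ q.2) * S.π q.2)
      (S.μ.prod (lebesgueOn X))) :
    S.avgDist t ξ ρ ≤ 2 * eLpNorm (fun q : X × X => S.p t q.1 q.2 - f q.1 (ξ q.2) * S.π q.2) 1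
      (S.μ.prod (lebesgueOn X)) := by
  -- The family `f` is arbitrary, so Fubini is applied to a measurable representative of the whole
  -- difference.
  let g := hf.mk
  have hgm : Measurable g := hf.stronglyMeasurable_mk.measurable
  have hae : ∀ᵐ y ∂(lebesgueOn X), ∀ᵐ x ∂S.μ, S.p t x y - f x (ξ y) * S.π y = g (x, y) := by
    have h1 := (Measure.measurePreserving_swap (μ := lebesgueOn X)
      (ν := S.μ)).quasiMeasurePreserving.ae hf.ae_eq_mk
    exact Measure.ae_ae_of_ae_prod h1
  let F : X → ℝ≥0∞ := fun y => ∫⁻ x, ‖g (x, y) / S.π y‖ₑ ∂S.μ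
  have hgF : Measurable fun q : X × X => ‖g q / S.π q.2‖ₑ :=
    (hgm.div (S.continuous_π.measurable.comp measurable_snd)).enorm
  have hF : Measurable F := hgF.lintegral_prod_left'
  have hsec : ∀ y, Measurable fun x => ‖g (x, y) / S.π y‖ₑ := fun y =>
    hgF.comp (measurable_id.prodMk measurable_const)
  have hnorm : eLpNorm (fun q : X × X => S.p t q.1 q.2 - f q.1 (ξ q.2) * S.π q.2) 1
      (S.μ.prod (lebesgueOn X)) = ∫⁻ y, F y ∂S.μ := by
    rw [eLpNorm_congr_ae hf.ae_eq_mk, eLpNorm_one_eq_lintegral_enorm,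
      lintegral_prod_symm' _ hgm.enorm, S.lintegral_μ hF]
    refine lintegral_congr fun y => ?_
    refine Eq.trans ?_ (lintegral_const_mul _ (hsec y))
    refine lintegral_congr fun x => ?_
    rw [← Real.enorm_of_nonneg (S.π_pos y).le, ← enorm_mul, mul_div_cancel₀ _ (S.π_pos y).ne']
  rw [hnorm, h.lintegral_eq F hF, h.avgDist_eq, ← lintegral_const_mul _ hF.lintegral_kernel]
  refine lintegral_mono_ae ?_
  filter_upwards [h.ae_ae_of_ae (S.μ_absolutelyContinuous.ae_le hae), h.ae_level]
    with z hz hlev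
  have hz' : ∀ᵐ y : X ∂(normalizedKernel κ z),
      (∀ᵐ x ∂S.μ, S.p t x y - f x (ξ y) * S.π y = g (x, y)) ∧ ξ y = z :=
    Measure.smul_absolutelyContinuous.ae_le (hz.and hlev)
  have hFsum : ∀ᵐ y₂ ∂(κ z), ∀ᵐ y₁ ∂(normalizedKernel κ z),
      S.observableDist t y₁ y₂ ≤ F y₁ + F y₂ := by
    filter_upwards [hz, hlev] with y₂ h2 h2z
    filter_upwards [hz'] with y₁ h1
    rw [observableDist_eq_lintegral, ← lintegral_add_left (hsec y₁)]
    refine lintegral_mono_ae ?_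
    filter_upwards [h1.1, h2] with x hx1 hx2
    -- Both points lie on the level set of `z`, so the terms `f x z` cancel.
    have e1 : S.p t x y₁ / S.π y₁ - S.p t x y₂ / S.π y₂ =
        g (x, y₁) / S.π y₁ - g (x, y₂) / S.π y₂ := by
      rw [← hx1, ← hx2, h1.2, h2z]
      have := (S.π_pos y₁).ne'
      have := (S.π_pos y₂).ne'
      field_simp
      ring
    rw [e1]
    exact enorm_sub_le
  calc _ ≤ ∫⁻ y₂, ∫⁻ y₁, (F y₁ + F y₂) ∂(normalizedKernel κ z) ∂(κ z) :=
        lintegral_mono_ae (hFsum.mono fun y₂ hy => lintegral_mono_ae hy)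
    -- Only `m⁻¹ * m ≤ 1` is used for the mass `m`, so zero and infinite mass need no separate
    -- treatment.
    _ ≤ ∫⁻ y₂, ((κ z Set.univ)⁻¹ * (∫⁻ y₁, F y₁ ∂(κ z)) + F y₂) ∂(κ z) := by
        refine lintegral_mono fun y₂ => ?_
        rw [lintegral_add_left hF, lintegral_const, normalizedKernel_apply,
          lintegral_smul_measure, smul_eq_mul, ← normalizedKernel_apply]
        gcongr
        exact mul_le_of_le_one_right zero_le (normalizedKernel_univ_le κ z)
    _ = (κ z Set.univ)⁻¹ * κ z Set.univ * (∫⁻ y₁, F y₁ ∂(κ z)) + ∫⁻ y₁, F y₁ ∂(κ z) := by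
        rw [lintegral_add_left measurable_const, lintegral_const]
        ring
    _ ≤ 2 * ∫⁻ y₁, F y₁ ∂(κ z) := by
        rw [two_mul]
        gcongr
        exact mul_le_of_le_one_left zero_le (ENNReal.inv_mul_le_one _)

/-- The average distance of the observables on level sets controls the error of the averaged
transition density. -/
theorem eLpNorm_le [SFinite (lebesgueOn X)] (ht : 0 < t) :
    AEStronglyMeasurable (fun q : X × X => S.p t q.1 q.2 -
      (⨍ y, S.p t q.1 y / S.π y ∂(S.marginal ξ (ξ q.2))) * S.π q.2) (S.μ.prod (lebesgueOn X)) ∧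
    eLpNorm (fun q : X × X => S.p t q.1 q.2 -
      (⨍ y, S.p t q.1 y / S.π y ∂(S.marginal ξ (ξ q.2))) * S.π q.2) 1 (S.μ.prod (lebesgueOn X)) ≤
      S.avgDist t ξ ρ := by
  let q : X × EuclideanSpace ℝ (Fin r) → ℝ := fun w =>
    ∫ y, S.p t w.1 y / S.π y ∂(normalizedKernel κ w.2)
  have hq : Measurable q := by
    have h1 : Measurable fun w : (X × EuclideanSpace ℝ (Fin r)) × X =>
        S.p t w.1.1 w.2 / S.π w.2 :=
      (measurable_div_π (S := S) ht).comp
        ((measurable_fst.comp measurable_fst).prodMk measurable_snd)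
    exact (h1.stronglyMeasurable.integral_kernel_prod_right'
      (κ := (normalizedKernel κ).prodMkLeft X)).measurable
  have hqξ : Measurable fun w : X × X => q (w.1, ξ w.2) :=
    hq.comp (measurable_fst.prodMk (h.continuous.measurable.comp measurable_snd))
  have hπ : Measurable S.π := S.continuous_π.measurable
  let G : X × X → ℝ := fun w => S.p t w.1 w.2 - q (w.1, ξ w.2) * S.π w.2
  have hG : Measurable G := (S.measurable_p t ht).sub (hqξ.mul (hπ.comp measurable_snd))
  have hGae : G =ᵐ[S.μ.prod (lebesgueOn X)] fun w : X × X => S.p t w.1 w.2 -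
      (⨍ y, S.p t w.1 y / S.π y ∂(S.marginal ξ (ξ w.2))) * S.π w.2 := by
    filter_upwards [Measure.quasiMeasurePreserving_snd.ae (h.ae_of_ae h.marginal_ae_eq)] with w hw
    simp only [G, q, hw, average]
    rfl
  refine ⟨hG.aestronglyMeasurable.congr hGae, ?_⟩
  rw [← eLpNorm_congr_ae hGae, eLpNorm_one_eq_lintegral_enorm, lintegral_prod_symm' _ hG.enorm]
  let H : X → ℝ≥0∞ := fun y => ∫⁻ x, ‖S.p t x y / S.π y - q (x, ξ y)‖ₑ ∂S.μ
  have hH' : Measurable fun w : X × X => ‖S.p t w.1 w.2 / S.π w.2 - q (w.1, ξ w.2)‖ₑ :=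
    ((measurable_div_π (S := S) ht).sub hqξ).enorm
  have hH : Measurable H := hH'.lintegral_prod_left'
  have h1 : ∀ y, ∫⁻ x, ‖G (x, y)‖ₑ ∂S.μ = ENNReal.ofReal (S.π y) * H y := by
    intro y
    have hsec : Measurable fun x => ‖S.p t x y / S.π y - q (x, ξ y)‖ₑ :=
      hH'.comp (measurable_id.prodMk measurable_const)
    refine Eq.trans ?_ (lintegral_const_mul _ hsec)
    refine lintegral_congr fun x => ?_
    rw [← Real.enorm_of_nonneg (S.π_pos y).le, ← enorm_mul]
    congr 1
    have := (S.π_pos y).ne'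
    simp only [G]
    field_simp
  simp only [h1]
  rw [← S.lintegral_μ hH, h.lintegral_eq H hH, h.avgDist_eq]
  refine lintegral_mono_ae ?_
  filter_upwards [h.ae_level, h.ae_finite] with z hlev hfin
  -- A level set of zero mass contributes nothing; otherwise the mass is finite and normalization
  -- gives a probability measure.
  rcases eq_or_ne (κ z) 0 with h0 | h0
  · simp [h0]
  refine lintegral_mono_ae ?_
  filter_upwards [hlev] with y hy
  have : IsProbabilityMeasure (normalizedKernel κ z) := ⟨by
    rw [normalizedKernel_apply, Measure.smul_apply, smul_eq_mul,
      ENNReal.inv_mul_cancel (by simpa using h0) hfin.ne]⟩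
  calc H y = ∫⁻ x, ‖S.p t x y / S.π y - ∫ y', S.p t x y' / S.π y' ∂(normalizedKernel κ z)‖ₑ ∂S.μ := by
        simp only [H, q, hy]
    _ ≤ ∫⁻ x, ∫⁻ y', ‖S.p t x y / S.π y - S.p t x y' / S.π y'‖ₑ ∂(normalizedKernel κ z) ∂S.μ :=
        lintegral_mono fun x => enorm_sub_integral_le ((measurable_p_right ht x).div hπ) _
    _ = ∫⁻ y', ∫⁻ x, ‖S.p t x y / S.π y - S.p t x y' / S.π y'‖ₑ ∂S.μ ∂(normalizedKernel κ z) := by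
        refine lintegral_lintegral_swap (Measurable.aemeasurable ?_)
        exact (((measurable_div_π (S := S) ht).comp (measurable_fst.prodMk measurable_const)).sub
          (measurable_div_π (S := S) ht)).enorm
    _ = ∫⁻ y', S.observableDist t y' y ∂(normalizedKernel κ z) := by
        refine lintegral_congr fun y' => ?_
        rw [observableDist_comm, observableDist_eq_lintegral]

end IsDisintegration

end MarkovSystem

/-! ### The two implications, with and without normalization. -/

namespace MarkovSystem

variable {n r : ℕ} {X : Set (EuclideanSpace ℝ (Fin n))} {S : MarkovSystem X} {τ : ℝ}
  {ξ : EuclideanSpace ℝ (Fin n) → EuclideanSpace ℝ (Fin r)}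
  {Z : Set (EuclideanSpace ℝ (Fin r))} {κ : Kernel (EuclideanSpace ℝ (Fin r)) X} {ε : ℝ≥0}

theorem isDiffDeflatable_iff
    (hprob : ∀ᵐ z ∂(volume.restrict Z), IsProbabilityMeasure (S.marginal ξ z)) :
    S.IsDiffDeflatable τ ξ Z ε ↔ S.IsAvgDiffDeflatable τ ξ Z ε := by
  rw [IsDiffDeflatable, IsAvgDiffDeflatable]
  have : ∫⁻ z in Z, ∫⁻ y₂, ∫⁻ y₁, S.observableDist τ y₁ y₂ ∂(S.marginal ξ z) ∂(S.marginal ξ z) =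
      ∫⁻ z in Z, ∫⁻ y₂, ⨍⁻ y₁, S.observableDist τ y₁ y₂ ∂(S.marginal ξ z) ∂(S.marginal ξ z) := by
    refine lintegral_congr_ae ?_
    filter_upwards [hprob] with z hz
    simp only [laverage_eq_lintegral]
  rw [this]

namespace IsDisintegration

variable (h : S.IsDisintegration ξ (volume.restrict Z) κ)
include h

theorem isAvgDiffDeflatable [SFinite (lebesgueOn X)] (hd : S.IsDeflatable τ ξ Z ε) :
    S.IsAvgDiffDeflatable τ ξ Z (2 * ε) := by
  obtain ⟨pD, hpD⟩ := hd
  obtain ⟨-, hLp, hε⟩ := hpD τ le_rfl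
  calc (volume Z)⁻¹ * S.avgDist τ ξ (volume.restrict Z)
      ≤ _ := mul_le_mul_right (h.avgDist_le hLp.1) _
    _ = 2 * _ := mul_left_comm _ _ _
    _ ≤ 2 * ε := mul_le_mul_right hε _
    _ = ((2 * ε : ℝ≥0) : ℝ≥0∞) := by push_cast; rfl

theorem isDeflatableWith_average [SFinite (lebesgueOn X)] (hτ : 0 < τ)
    (hd : S.IsAvgDiffDeflatable τ ξ Z ε) :
    S.IsDeflatableWith τ ξ Z (fun t x z => ⨍ y, S.p t x y / S.π y ∂(S.marginal ξ z)) ε := by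
  intro t hτt
  have ht : 0 < t := hτ.trans_le hτt
  obtain ⟨hm, hle⟩ := h.eLpNorm_le ht
  -- Membership in `L¹` cannot be read off from the hypothesis when `Z` has infinite volume, since
  -- the prefactor is then zero; the bound by 2 is used instead.
  refine ⟨fun x z _ => integral_nonneg fun y => div_nonneg (S.p_nonneg t ht x y) (S.π_pos y).le,
    ⟨hm, (hle.trans (h.avgDist_le_two ht)).trans_lt ENNReal.ofNat_lt_top⟩, ?_⟩
  refine le_trans ?_ hd
  gcongr
  exact hle.trans (avgDist_antitone hτ hτt)

/-- Mean and integral agree for almost every `z`, hence at `ξ y` for almost every `y`, because `ξ`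
pulls null sets of levels back to null sets. -/
theorem isDeflatableWith_integral
    (hprob : ∀ᵐ z ∂(volume.restrict Z), IsProbabilityMeasure (S.marginal ξ z)) (hτ : 0 < τ)
    (hd : S.IsDeflatableWith τ ξ Z (fun t x z => ⨍ y, S.p t x y / S.π y ∂(S.marginal ξ z)) ε) :
    S.IsDeflatableWith τ ξ Z (fun t x z => ∫ y, S.p t x y / S.π y ∂(S.marginal ξ z)) ε := by
  intro t hτt
  have ht : 0 < t := hτ.trans_le hτt
  obtain ⟨-, hLp, hε⟩ := hd t hτt
  have hae : (fun q : X × X => S.p t q.1 q.2 -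
      (⨍ y, S.p t q.1 y / S.π y ∂(S.marginal ξ (ξ q.2))) * S.π q.2)
      =ᵐ[S.μ.prod (lebesgueOn X)] fun q : X × X => S.p t q.1 q.2 -
      (∫ y, S.p t q.1 y / S.π y ∂(S.marginal ξ (ξ q.2))) * S.π q.2 := by
    filter_upwards [Measure.quasiMeasurePreserving_snd.ae (h.ae_of_ae hprob)] with q hq
    rw [average_eq_integral]
  refine ⟨fun x z _ => integral_nonneg fun y => div_nonneg (S.p_nonneg t ht x y) (S.π_pos y).le,
    (memLp_congr_ae hae).1 hLp, ?_⟩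
  rwa [← eLpNorm_congr_ae hae]

end IsDisintegration

end MarkovSystem

end ReactionCoordinate

end

theorem mainTheorem7 {n r : ℕ} (hrn : r ≤ n)
    (X : Set (EuclideanSpace ℝ (Fin n))) (hX : NullMeasurableSet X volume)
    (S : ReactionCoordinate.MarkovSystem X) (τ : ℝ) (hτ : 0 < τ)
    (Z : Set (EuclideanSpace ℝ (Fin r))) (hZ : MeasurableSet Z)
    -- the reaction coordinate: `C¹` near `X`, with values in `Z` on `X`
    (ξ : EuclideanSpace ℝ (Fin n) → EuclideanSpace ℝ (Fin r))
    (U : Set (EuclideanSpace ℝ (Fin n))) (hU : IsOpen U) (hXU : X ⊆ U)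
    (hξ : ContDiffOn ℝ 1 ξ U) (hξZ : Set.MapsTo ξ X Z)
    -- almost every point of `X` is a regular point of `ξ`
    (hreg : ∀ᵐ x : X ∂(ReactionCoordinate.lebesgueOn X), (ReactionCoordinate.gramMatrix ξ x).det ≠ 0)
    (ε : ℝ≥0) :
    -- the statement for marginal measures `μ_z` that are probability measures
    ((∀ᵐ z ∂(volume.restrict Z), IsProbabilityMeasure (S.marginal ξ z)) →
      (S.IsDeflatable τ ξ Z ε → S.IsDiffDeflatable τ ξ Z (2 * ε)) ∧
      (S.IsDiffDeflatable τ ξ Z ε →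
        S.IsDeflatable τ ξ Z ε ∧
        S.IsDeflatableWith τ ξ Z (fun t x z => ∫ y, S.p t x y / S.π y ∂(S.marginal ξ z)) ε)) ∧
    -- the statement without normalization of the marginal measures
    (S.IsDeflatable τ ξ Z ε → S.IsAvgDiffDeflatable τ ξ Z (2 * ε)) ∧
    (S.IsAvgDiffDeflatable τ ξ Z ε →
      S.IsDeflatable τ ξ Z ε ∧
      S.IsDeflatableWith τ ξ Z (fun t x z => ⨍ y, S.p t x y / S.π y ∂(S.marginal ξ z)) ε) := by

  obtain ⟨κ, hκ, hint⟩ :=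
    ReactionCoordinate.exists_kernel_marginal hX S hZ hU hXU hξ hξZ hreg
  have h : S.IsDisintegration ξ (volume.restrict Z) κ :=
    ⟨ReactionCoordinate.continuous_restrict_of_contDiffOn hXU hξ, hκ, hint⟩
  have := S.sFinite_lebesgueOn hX
  refine ⟨fun hprob => ⟨fun hd => ?_, fun hd => ?_⟩, h.isAvgDiffDeflatable, fun hd =>
    ⟨⟨_, h.isDeflatableWith_average hτ hd⟩, h.isDeflatableWith_average hτ hd⟩⟩
  · exact (ReactionCoordinate.MarkovSystem.isDiffDeflatable_iff hprob).2 (h.isAvgDiffDeflatable hd)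
  · have hw := h.isDeflatableWith_integral hprob hτ (h.isDeflatableWith_average hτ
      ((ReactionCoordinate.MarkovSystem.isDiffDeflatable_iff hprob).1 hd))
    exact ⟨⟨_, hw⟩, hw⟩
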